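/- Let $\zeta(s)$ denote the Riemann zeta-function, and for $T\ge 3$ put \[ I(T)=\int_{-T}^{T}\frac{\log|\zeta(\tfrac12+it)|}{\tfrac14+t^2}\,dt , \] where the integral converges absolutely. Then, unconditionally and uniformly for $T\ge 3$, \[ I(T)=2\pi\sum_{\substack{-T\le\gamma\le T\\ \beta>1/2}}\log\left|\frac{\rho}{1-\rho}\right|+O\!\left(\frac{1}{T^2}\log T\right), \] where the sum runs over the nontrivial zeros $\rho=\beta+i\gamma$ of $\zeta(s)$ (the zeros with $0<\beta<1$) satisfying $\beta>1/2$ and $-T\le\gamma\le T$, each counted with its multiplicity, and the implied constant is absolute. -/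

import Mathlib

namespace BalazardSaiasYor

/-- The nontrivial zeros of the Riemann zeta-function: its zeros in the open critical strip. -/
def nontrivialZeros : Set ℂ :=
  {ρ | riemannZeta ρ = 0 ∧ 0 < ρ.re ∧ ρ.re < 1}

/-- The nontrivial zeros `ρ = β + iγ` with `-T ≤ γ ≤ T` and `β > 1/2`. -/
def zerosRightOfLine (T : ℝ) : Set ℂ :=
  {ρ | ρ ∈ nontrivialZeros ∧ (-T ≤ ρ.im ∧ ρ.im ≤ T) ∧ 1 / 2 < ρ.re}

theorem zerosRightOfLine_finite (T : ℝ) : (zerosRightOfLine T).Finite := by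
  have hK : IsCompact (Set.Icc (0 : ℝ) 1 ×ℂ Set.Icc (-T) T) :=
    isCompact_Icc.reProdIm isCompact_Icc
  refine hK.inter_riemannZetaZeros_finite.subset ?_
  rintro ρ ⟨⟨h0, h1, h2⟩, h3, -⟩
  exact ⟨⟨⟨h1.le, h2.le⟩, h3⟩, h0⟩

/-- The integrand `log |ζ(1/2 + it)| / (1/4 + t ^ 2)`. -/
noncomputable def integrand (t : ℝ) : ℝ :=
  Real.log ‖riemannZeta (1 / 2 + (t : ℂ) * Complex.I)‖ / (1 / 4 + t ^ 2)

/-- The truncated integral `I(T)`. -/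
noncomputable def truncatedIntegral (T : ℝ) : ℝ :=
  ∫ t in (-T)..T, integrand t

/-- The sum of `log |ρ / (1 - ρ)|` over the nontrivial zeros `ρ = β + iγ` with `-T ≤ γ ≤ T` and
`β > 1/2`, each zero being counted with its multiplicity. -/
noncomputable def zeroSum (T : ℝ) : ℝ :=
  ∑ ρ ∈ (zerosRightOfLine_finite T).toFinset,
    (analyticOrderNatAt riemannZeta ρ : ℝ) * Real.log ‖ρ / (1 - ρ)‖

end BalazardSaiasYor

/-!
Apply Green's second identity on the half-plane `re z > 1 / 2` to `log |ζ|` and to the harmonic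
function `log |z / (1 - z)|` multiplied by a smooth cut-off of the square of side `2S`. The latter
function vanishes on the critical line, where its inward normal derivative is `1 / (1 / 4 + t ^ 2)`:
the boundary term is a smoothed integral, and each zero of `ζ` contributes
`2π log |ρ / (1 - ρ)|`. Both functions have the singularity `-log |z - 1|` at `1`, and the
contributions of these two poles cancel.

The error term is the integral of `log |ζ|` against the commutator of the Laplacian with the
cut-off. This commutator lives near the boundary of the square, where it is `O(re z / S ^ 2)`.
There Jensen's inequality bounds the `L¹` norm of `log |ζ|` on discs of fixed radius by `O(log S)`,
and `log |ζ|` decays rapidly as `re z` grows. Finally the sharp truncation at `T` is squeezed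
between the cut-offs at `T - 1` and `T`: the zeros have nonnegative weights, and the integrand is
bounded above by `O(log T / T ^ 2)` at heights close to `T`.
-/

namespace BalazardSaiasYor

open Set MeasureTheory Filter Topology Metric InnerProductSpace
open Complex (I)
open scoped Laplacian

section Laplacian

theorem contDiff_fderiv_apply {f : ℂ → ℝ} (hf : ContDiff ℝ 2 f) (v : ℂ) :
    ContDiff ℝ 1 fun z ↦ fderiv ℝ f z v :=
  (hf.fderiv_right le_rfl).clm_apply contDiff_const

theorem laplacian_eq_fderiv_fderiv {f : ℂ → ℝ} {z : ℂ} (hf : ContDiffAt ℝ 2 f z) :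
    Δ f z = fderiv ℝ (fun w ↦ fderiv ℝ f w 1) z 1 + fderiv ℝ (fun w ↦ fderiv ℝ f w I) z I := by
  have h : DifferentiableAt ℝ (fderiv ℝ f) z :=
    (hf.fderiv_right (m := 1) le_rfl).differentiableAt one_ne_zero
  simp [laplacian_eq_iteratedFDeriv_complexPlane, iteratedFDeriv_two_apply,
    fderiv_clm_apply h (differentiableAt_const _)]

theorem continuous_laplacian {f : ℂ → ℝ} (hf : ContDiff ℝ 2 f) : Continuous (Δ f) := by
  have h (v : ℂ) : Continuous fun z ↦ fderiv ℝ (fun w ↦ fderiv ℝ f w v) z v :=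
    ((contDiff_fderiv_apply hf v).continuous_fderiv one_ne_zero).clm_apply continuous_const
  exact ((h 1).add (h I)).congr fun z ↦ (laplacian_eq_fderiv_fderiv hf.contDiffAt).symm

theorem laplacian_eq_zero_of_notMem_tsupport {f : ℂ → ℝ} {z : ℂ} (hz : z ∉ tsupport f) :
    Δ f z = 0 := by
  have h0 : f =ᶠ[𝓝 z] fun _ ↦ 0 := notMem_tsupport_iff_eventuallyEq.1 hz
  rw [(laplacian_congr_nhds h0).eq_of_nhds]
  simp

theorem laplacian_mul {f g : ℂ → ℝ} (hf : ContDiff ℝ 2 f) (hg : ContDiff ℝ 2 g) (z : ℂ) :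
    Δ (fun w ↦ f w * g w) z = f z * Δ g z + g z * Δ f z +
      2 * (fderiv ℝ f z 1 * fderiv ℝ g z 1 + fderiv ℝ f z I * fderiv ℝ g z I) := by
  have df : Differentiable ℝ f := hf.differentiable two_ne_zero
  have dg : Differentiable ℝ g := hg.differentiable two_ne_zero
  have second (v : ℂ) : fderiv ℝ (fun w ↦ fderiv ℝ (fun w ↦ f w * g w) w v) z v =
      f z * fderiv ℝ (fun w ↦ fderiv ℝ g w v) z v + g z * fderiv ℝ (fun w ↦ fderiv ℝ f w v) z v +
        2 * (fderiv ℝ f z v * fderiv ℝ g z v) := by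
    have dfv := (contDiff_fderiv_apply hf v).differentiable one_ne_zero
    have dgv := (contDiff_fderiv_apply hg v).differentiable one_ne_zero
    have first : (fun w ↦ fderiv ℝ (fun w ↦ f w * g w) w v) =
        fun w ↦ f w * fderiv ℝ g w v + g w * fderiv ℝ f w v := by
      ext w; simp [fderiv_fun_mul (df w) (dg w)]
    rw [first, fderiv_fun_add ((df z).fun_mul (dgv z)) ((dg z).fun_mul (dfv z)),
      fderiv_fun_mul (df z) (dgv z), fderiv_fun_mul (dg z) (dfv z)]
    simp only [add_apply, smul_apply, smul_eq_mul]
    ring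
  rw [laplacian_eq_fderiv_fderiv (hf.mul hg).contDiffAt, laplacian_eq_fderiv_fderiv hf.contDiffAt,
    laplacian_eq_fderiv_fderiv hg.contDiffAt, second, second]
  ring

end Laplacian

section HalfPlane

variable {E : Type*} [NormedAddCommGroup E]

theorem measurableSet_halfPlane (a : ℝ) : MeasurableSet {z : ℂ | a < z.re} :=
  measurableSet_lt measurable_const Complex.measurable_re

theorem integrable_comp_re_add_im {f : ℂ → E} (hf : Integrable f) :
    Integrable fun p : ℝ × ℝ ↦ f (p.1 + p.2 * I) := by
  have := (Complex.volume_preserving_equiv_real_prod.symm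
    Complex.measurableEquivRealProd).integrable_comp_emb
    Complex.measurableEquivRealProd.symm.measurableEmbedding |>.2 hf
  refine this.congr (.of_forall fun p ↦ ?_)
  simp [Complex.measurableEquivRealProd_symm_apply, Complex.mk_eq_add_mul_I]

variable [NormedSpace ℝ E]

theorem setIntegral_halfPlane_eq_prod (a : ℝ) (f : ℂ → E) :
    ∫ z in {z : ℂ | a < z.re}, f z = ∫ p in Ioi a ×ˢ (univ : Set ℝ), f (p.1 + p.2 * I) := by
  have hpre : {z : ℂ | a < z.re} = Complex.measurableEquivRealProd ⁻¹' (Ioi a ×ˢ univ) := by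
    ext z; simp [Complex.measurableEquivRealProd]
  rw [hpre, ← Complex.volume_preserving_equiv_real_prod.setIntegral_preimage_emb
    Complex.measurableEquivRealProd.measurableEmbedding]
  simp [Complex.measurableEquivRealProd, Complex.re_add_im]

theorem isClosedEmbedding_add_mul_I (x : ℝ) :
    IsClosedEmbedding fun y : ℝ ↦ (x + y * I : ℂ) := by
  refine Isometry.isClosedEmbedding (Isometry.of_dist_eq fun y y' ↦ ?_)
  rw [Complex.dist_eq, Real.dist_eq, ← Real.norm_eq_abs, ← Complex.norm_real,
    add_sub_add_left_eq_sub, ← sub_mul, norm_mul, Complex.norm_I, mul_one, Complex.ofReal_sub]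

theorem isClosedEmbedding_ofReal_add (c : ℂ) : IsClosedEmbedding fun x : ℝ ↦ (x + c : ℂ) :=
  (Homeomorph.addRight c).isClosedEmbedding.comp Complex.isometry_ofReal.isClosedEmbedding

theorem integrable_fderiv_apply {f : ℂ → E} (hf : ContDiff ℝ 1 f) (hc : HasCompactSupport f)
    (v : ℂ) : Integrable fun z ↦ fderiv ℝ f z v :=
  ((hf.continuous_fderiv one_ne_zero).clm_apply continuous_const).integrable_of_hasCompactSupport
    (hc.fderiv_apply ℝ v)

theorem integral_halfPlane_fderiv_I {f : ℂ → E} (hf : ContDiff ℝ 1 f) (hc : HasCompactSupport f)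
    (a : ℝ) : ∫ z in {z : ℂ | a < z.re}, fderiv ℝ f z I = 0 := by
  have hint := integrable_fderiv_apply hf hc I
  have inner (x : ℝ) : ∫ y : ℝ, fderiv ℝ f (x + y * I) I = 0 := by
    have hline (y : ℝ) : HasDerivAt (fun y : ℝ ↦ (x + y * I : ℂ)) I y := by
      simpa using ((Complex.ofRealCLM.hasDerivAt (x := y)).mul_const I).const_add (x : ℂ)
    have hemb := isClosedEmbedding_add_mul_I x
    refine integral_eq_zero_of_hasDerivAt_of_integrable (f := fun y : ℝ ↦ f (x + y * I))
      (fun y ↦ (hf.differentiable one_ne_zero _).hasFDerivAt.comp_hasDerivAt y (hline y)) ?_ ?_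
    · exact (((hf.continuous_fderiv one_ne_zero).clm_apply continuous_const).comp
        hemb.continuous).integrable_of_hasCompactSupport
        ((hc.fderiv_apply ℝ I).comp_isClosedEmbedding hemb)
    · exact (hf.continuous.comp hemb.continuous).integrable_of_hasCompactSupport
        (hc.comp_isClosedEmbedding hemb)
  rw [setIntegral_halfPlane_eq_prod, Measure.volume_eq_prod, setIntegral_prod]
  · simp_rw [Measure.restrict_univ, inner, integral_zero]
  · exact (integrable_comp_re_add_im hint).integrableOn

theorem integral_halfPlane_fderiv_one [CompleteSpace E] {f : ℂ → E} (hf : ContDiff ℝ 1 f)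
    (hc : HasCompactSupport f) (a : ℝ) :
    ∫ z in {z : ℂ | a < z.re}, fderiv ℝ f z 1 = -∫ y : ℝ, f (a + y * I) := by
  have hint := integrable_fderiv_apply hf hc 1
  have inner (y : ℝ) : ∫ x in Ioi a, fderiv ℝ f (x + y * I) 1 = -f (a + y * I) := by
    have hd (x : ℝ) : HasDerivAt (fun x : ℝ ↦ f (x + y * I)) (fderiv ℝ f (x + y * I) 1) x :=
      (hf.differentiable one_ne_zero _).hasFDerivAt.comp_hasDerivAt x
        (((Complex.ofRealCLM.hasDerivAt (x := x))).add_const (y * I))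
    have hc' : HasCompactSupport fun x : ℝ ↦ f (x + y * I) :=
      hc.comp_isClosedEmbedding (isClosedEmbedding_ofReal_add (y * I))
    have hC : ContDiff ℝ 1 fun x : ℝ ↦ f (x + y * I) :=
      hf.comp (Complex.ofRealCLM.contDiff.add contDiff_const)
    rw [← hc'.integral_Ioi_deriv_eq hC]
    simp_rw [(hd _).deriv]
  rw [setIntegral_halfPlane_eq_prod, Measure.volume_eq_prod, ← Measure.prod_restrict,
    integral_prod_symm, ← integral_neg, Measure.restrict_univ]
  · simp_rw [inner]
  · rw [Measure.prod_restrict]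
    exact (integrable_comp_re_add_im hint).integrableOn

end HalfPlane

section Green

variable {a : ℝ} {φ u : ℂ → ℝ}

theorem fderiv_mul_fderiv_sub_mul_fderiv (hφ : ContDiff ℝ 2 φ) (hu : ContDiff ℝ 2 u) (v z : ℂ) :
    fderiv ℝ (fun w ↦ φ w * fderiv ℝ u w v - u w * fderiv ℝ φ w v) z v =
      φ z * fderiv ℝ (fun w ↦ fderiv ℝ u w v) z v -
        u z * fderiv ℝ (fun w ↦ fderiv ℝ φ w v) z v := by
  have dφ : DifferentiableAt ℝ φ z := hφ.differentiable two_ne_zero z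
  have du : DifferentiableAt ℝ u z := hu.differentiable two_ne_zero z
  have dφv := (contDiff_fderiv_apply hφ v).differentiable one_ne_zero z
  have duv := (contDiff_fderiv_apply hu v).differentiable one_ne_zero z
  rw [fderiv_fun_sub (dφ.fun_mul duv) (du.fun_mul dφv), fderiv_fun_mul dφ duv,
    fderiv_fun_mul du dφv]
  simp only [sub_apply, add_apply,
    smul_apply, smul_eq_mul]
  ring

/-- The functions used to test a Laplacian on the half-plane `a < re z`: compactly supported `C²`
functions vanishing on the boundary line, where their normal derivative is left free. -/
structure IsTestFunction (a : ℝ) (φ : ℂ → ℝ) : Prop where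
  contDiff : ContDiff ℝ 2 φ
  hasCompactSupport : HasCompactSupport φ
  eq_zero : ∀ y : ℝ, φ (a + y * I) = 0

namespace IsTestFunction

variable (hφ : IsTestFunction a φ)
include hφ

theorem continuous_fderiv_apply (v : ℂ) : Continuous fun z ↦ fderiv ℝ φ z v :=
  (contDiff_fderiv_apply hφ.contDiff v).continuous

theorem hasCompactSupport_laplacian : HasCompactSupport (Δ φ) :=
  hφ.hasCompactSupport.mono' fun _ hz ↦ by_contra fun h ↦
    hz (laplacian_eq_zero_of_notMem_tsupport h)

theorem continuous_indicator : Continuous ({z : ℂ | a < z.re}.indicator φ) := by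
  refine _root_.continuous_indicator (fun z hz ↦ ?_) hφ.contDiff.continuous.continuousOn
  have hre : z.re = a := (frontier_lt_subset_eq continuous_const Complex.continuous_re hz).symm
  rw [← hφ.eq_zero z.im, ← hre, Complex.re_add_im]

theorem integrable_mul_fderiv (hu : Continuous u) :
    Integrable fun y : ℝ ↦ u (a + y * I) * fderiv ℝ φ (a + y * I) 1 := by
  have hemb := isClosedEmbedding_add_mul_I a
  exact ((hu.comp hemb.continuous).mul
    ((hφ.continuous_fderiv_apply 1).comp hemb.continuous)).integrable_of_hasCompactSupport
    ((hφ.hasCompactSupport.fderiv_apply ℝ 1).comp_isClosedEmbedding hemb).mul_left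

theorem integrable_mul_laplacian (hu : Continuous u) : Integrable fun z ↦ u z * Δ φ z :=
  (hu.mul (continuous_laplacian hφ.contDiff)).integrable_of_hasCompactSupport
    hφ.hasCompactSupport_laplacian.mul_left

theorem green_identity (hu : ContDiff ℝ 2 u) :
    (∫ y : ℝ, u (a + y * I) * fderiv ℝ φ (a + y * I) 1) +
      ∫ z in {z : ℂ | a < z.re}, u z * Δ φ z = ∫ z in {z : ℂ | a < z.re}, φ z * Δ u z := by
  have hC := hφ.contDiff
  set P : ℂ → ℂ → ℝ := fun v z ↦ φ z * fderiv ℝ u z v - u z * fderiv ℝ φ z v with hP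
  have P_contDiff (v : ℂ) : ContDiff ℝ 1 (P v) :=
    ((hC.of_le one_le_two).mul (contDiff_fderiv_apply hu v)).sub
      ((hu.of_le one_le_two).mul (contDiff_fderiv_apply hC v))
  have P_compact (v : ℂ) : HasCompactSupport (P v) :=
    hφ.hasCompactSupport.mul_right.sub (hφ.hasCompactSupport.fderiv_apply ℝ v).mul_left
  have divergence (z : ℂ) :
      fderiv ℝ (P 1) z 1 + fderiv ℝ (P I) z I = φ z * Δ u z - u z * Δ φ z := by
    simp only [hP, fderiv_mul_fderiv_sub_mul_fderiv hC hu, laplacian_eq_fderiv_fderiv hC.contDiffAt,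
      laplacian_eq_fderiv_fderiv hu.contDiffAt]
    ring
  have hφΔu : Integrable fun z ↦ φ z * Δ u z :=
    (hC.continuous.mul (continuous_laplacian hu)).integrable_of_hasCompactSupport
      hφ.hasCompactSupport.mul_right
  have boundary (y : ℝ) : P 1 (a + y * I) = -(u (a + y * I) * fderiv ℝ φ (a + y * I) 1) := by
    simp [hP, hφ.eq_zero]
  have key : ∫ z in {z : ℂ | a < z.re}, (fderiv ℝ (P 1) z 1 + fderiv ℝ (P I) z I) =
      ∫ y : ℝ, u (a + y * I) * fderiv ℝ φ (a + y * I) 1 := by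
    rw [integral_add (integrable_fderiv_apply (P_contDiff 1) (P_compact 1) 1).integrableOn
        (integrable_fderiv_apply (P_contDiff I) (P_compact I) I).integrableOn,
      integral_halfPlane_fderiv_one (P_contDiff 1) (P_compact 1),
      integral_halfPlane_fderiv_I (P_contDiff I) (P_compact I), add_zero]
    simp_rw [boundary, integral_neg, neg_neg]
  simp_rw [divergence] at key
  rw [← key, integral_sub hφΔu.integrableOn
    (hφ.integrable_mul_laplacian hu.continuous).integrableOn]
  ring

end IsTestFunction

end Green

section GreenIdentity

variable {a m m' : ℝ} {φ u v : ℂ → ℝ}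

/-- Green's formula on the half-plane `a < re z` for a function `u` that need not be smooth, tested
against `φ`: the number `m` is the integral of `φ` against the distributional Laplacian of `u`. -/
structure GreenIdentity (a : ℝ) (φ u : ℂ → ℝ) (m : ℝ) : Prop where
  integrable_boundary : Integrable fun y : ℝ ↦ u (a + y * I) * fderiv ℝ φ (a + y * I) 1
  integrableOn : IntegrableOn (fun z ↦ u z * Δ φ z) {z : ℂ | a < z.re}
  integral_add_setIntegral : (∫ y : ℝ, u (a + y * I) * fderiv ℝ φ (a + y * I) 1) +
    ∫ z in {z : ℂ | a < z.re}, u z * Δ φ z = m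

theorem exists_contDiff_eventuallyEq {E F : Type*} [NormedAddCommGroup E] [NormedSpace ℝ E]
    [FiniteDimensional ℝ E] [NormedAddCommGroup F] [NormedSpace ℝ F] {f : E → F} {K : Set E}
    {n : ℕ} (hK : IsCompact K) (hf : ∀ x ∈ K, ContDiffAt ℝ n f x) :
    ∃ g : E → F, ContDiff ℝ n g ∧ ∀ x ∈ K, g =ᶠ[𝓝 x] f := by
  set U : Set E := {x | ContDiffAt ℝ n f x}
  have hU : IsOpen U := isOpen_iff_mem_nhds.2 fun x (hx : ContDiffAt ℝ n f x) ↦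
    hx.eventually (by simp)
  obtain ⟨L, hL, hKL, hLU⟩ := exists_compact_between hK hU hf
  obtain ⟨b, hb_one, hb_zero, -⟩ := exists_contMDiffMap_one_nhds_of_subset_interior (n := n)
    (modelWithCornersSelf ℝ E) hK.isClosed hKL
  refine ⟨fun x ↦ b x • f x, contDiff_iff_contDiffAt.2 fun x ↦ ?_, fun x hx ↦ ?_⟩
  · by_cases hx : x ∈ U
    · exact b.contMDiff.contDiff.contDiffAt.smul hx
    · have hzero : (fun x ↦ b x • f x) =ᶠ[𝓝 x] fun _ ↦ 0 := by
        filter_upwards [hL.isClosed.isOpen_compl.mem_nhds fun h ↦ hx (hLU h)] with y hy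
        rw [hb_zero y hy, zero_smul]
      exact contDiffAt_const.congr_of_eventuallyEq hzero
  · filter_upwards [hb_one.filter_mono (nhds_le_nhdsSet hx)] with y hy
    rw [hy, one_smul]

namespace GreenIdentity

theorem of_contDiff (hφ : IsTestFunction a φ) (hu : ContDiff ℝ 2 u) :
    GreenIdentity a φ u (∫ z in {z : ℂ | a < z.re}, φ z * Δ u z) where
  integrable_boundary := hφ.integrable_mul_fderiv hu.continuous
  integrableOn := (hφ.integrable_mul_laplacian hu.continuous).integrableOn
  integral_add_setIntegral := hφ.green_identity hu

theorem add (hu : GreenIdentity a φ u m) (hv : GreenIdentity a φ v m') :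
    GreenIdentity a φ (fun z ↦ u z + v z) (m + m') where
  integrable_boundary := by
    simpa only [add_mul] using hu.integrable_boundary.fun_add hv.integrable_boundary
  integrableOn := by simpa only [add_mul] using hu.integrableOn.fun_add hv.integrableOn
  integral_add_setIntegral := by
    simp_rw [add_mul]
    rw [integral_add hu.integrable_boundary hv.integrable_boundary,
      integral_add hu.integrableOn hv.integrableOn, ← hu.integral_add_setIntegral,
      ← hv.integral_add_setIntegral]
    ring

theorem const_mul (c : ℝ) (hu : GreenIdentity a φ u m) :
    GreenIdentity a φ (fun z ↦ c * u z) (c * m) where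
  integrable_boundary := by simpa only [mul_assoc] using hu.integrable_boundary.const_mul c
  integrableOn := by
    simpa only [IntegrableOn, mul_assoc] using hu.integrableOn.const_mul c
  integral_add_setIntegral := by
    simp_rw [mul_assoc, integral_const_mul, ← mul_add, hu.integral_add_setIntegral]

theorem sum {ι : Type*} {w : ι → ℂ → ℝ} {k : ι → ℝ} (s : Finset ι)
    (h : ∀ i ∈ s, GreenIdentity a φ (w i) (k i)) :
    GreenIdentity a φ (fun z ↦ ∑ i ∈ s, w i z) (∑ i ∈ s, k i) := by
  classical
  induction s using Finset.induction_on with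
  | empty => exact ⟨by simp, by simp, by simp⟩
  | insert i s hi ih =>
    simp_rw [Finset.sum_insert hi]
    exact (h i (Finset.mem_insert_self i s)).add
      (ih fun j hj ↦ h j (Finset.mem_insert_of_mem hj))

theorem congr_ae (hu : GreenIdentity a φ u m)
    (hline : ∀ᵐ y : ℝ, fderiv ℝ φ (a + y * I) 1 ≠ 0 → u (a + y * I) = v (a + y * I))
    (hplane : ∀ᵐ z : ℂ, a < z.re → Δ φ z ≠ 0 → u z = v z) : GreenIdentity a φ v m := by
  have line : (fun y : ℝ ↦ u (a + y * I) * fderiv ℝ φ (a + y * I) 1) =ᵐ[volume]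
      fun y : ℝ ↦ v (a + y * I) * fderiv ℝ φ (a + y * I) 1 := by
    filter_upwards [hline] with y hy
    by_cases h : fderiv ℝ φ (a + y * I) 1 = 0
    · simp [h]
    · rw [hy h]
  have plane : (fun z ↦ u z * Δ φ z) =ᵐ[volume.restrict {z : ℂ | a < z.re}]
      fun z ↦ v z * Δ φ z := by
    filter_upwards [ae_restrict_of_ae hplane, ae_restrict_mem (measurableSet_halfPlane a)]
      with z hz hmem
    by_cases h : Δ φ z = 0
    · simp [h]
    · rw [hz hmem h]
  exact ⟨hu.integrable_boundary.congr line, hu.integrableOn.congr plane, by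
    rw [← integral_congr_ae line, ← integral_congr_ae plane, hu.integral_add_setIntegral]⟩

theorem of_harmonicOnNhd (hφ : IsTestFunction a φ)
    (hu : HarmonicOnNhd u (tsupport φ ∩ {z | a ≤ z.re})) : GreenIdentity a φ u 0 := by
  set K : Set ℂ := tsupport φ ∩ {z | a ≤ z.re}
  obtain ⟨v, hv, huv⟩ : ∃ v : ℂ → ℝ, ContDiff ℝ 2 v ∧ ∀ z ∈ K, v =ᶠ[𝓝 z] u :=
    exists_contDiff_eventuallyEq
      (hφ.hasCompactSupport.isCompact.inter_right
        (isClosed_le continuous_const Complex.continuous_re)) fun z hz ↦ (hu z hz).1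
  have mem_K {z : ℂ} (hre : a ≤ z.re) (hz : z ∈ tsupport φ) : z ∈ K := ⟨hz, hre⟩
  have mass : ∫ z in {z : ℂ | a < z.re}, φ z * Δ v z = 0 := by
    refine setIntegral_eq_zero_of_forall_eq_zero fun z hz ↦ ?_
    by_cases h : z ∈ tsupport φ
    · have hK := mem_K hz.le h
      rw [(laplacian_congr_nhds (huv z hK)).eq_of_nhds, (hu z hK).2.eq_of_nhds, Pi.zero_apply,
        mul_zero]
    · rw [image_eq_zero_of_notMem_tsupport h, zero_mul]
  rw [← mass]
  refine (of_contDiff hφ hv).congr_ae (.of_forall fun y hy ↦ ?_) (.of_forall fun z hre hz ↦ ?_)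
  · refine (huv _ (mem_K (by simp) ?_)).eq_of_nhds
    exact support_fderiv_subset ℝ fun h ↦ hy (by rw [h]; rfl)
  · refine (huv z (mem_K hre.le ?_)).eq_of_nhds
    exact not_imp_comm.1 laplacian_eq_zero_of_notMem_tsupport hz

end GreenIdentity

end GreenIdentity

section Radial

theorem laplacian_comp_sq_norm_sub {g g' : ℝ → ℝ} {g'' : ℝ} {w z : ℂ}
    (hf : ContDiffAt ℝ 2 (fun z ↦ g (‖z - w‖ ^ 2)) z) (hg : ∀ t, 0 ≤ t → HasDerivAt g (g' t) t)
    (hg' : HasDerivAt g' g'' (‖z - w‖ ^ 2)) :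
    Δ (fun z ↦ g (‖z - w‖ ^ 2)) z = 4 * (g' (‖z - w‖ ^ 2) + ‖z - w‖ ^ 2 * g'') := by
  have dsq (z : ℂ) : HasFDerivAt (fun z : ℂ ↦ ‖z - w‖ ^ 2) (2 • innerSL ℝ (z - w)) z :=
    (hasFDerivAt_sub_const w).norm_sq
  have first (v : ℂ) : (fun z ↦ fderiv ℝ (fun z ↦ g (‖z - w‖ ^ 2)) z v) =
      fun z ↦ g' (‖z - w‖ ^ 2) * (2 * inner ℝ v (z - w)) := by
    ext z
    have h : HasFDerivAt (fun z ↦ g (‖z - w‖ ^ 2)) _ z :=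
      (hg _ (sq_nonneg ‖z - w‖)).comp_hasFDerivAt z (dsq z)
    rw [h.fderiv]
    simp only [smul_apply, smul_eq_mul, innerSL_apply_apply, real_inner_comm v, nsmul_eq_mul,
      Nat.cast_ofNat]
  have second (v : ℂ) : fderiv ℝ (fun z ↦ fderiv ℝ (fun z ↦ g (‖z - w‖ ^ 2)) z v) z v =
      g'' * (2 * inner ℝ v (z - w)) ^ 2 + g' (‖z - w‖ ^ 2) * (2 * ‖v‖ ^ 2) := by
    have dinner : HasFDerivAt (fun z ↦ 2 * inner ℝ v (z - w)) ((2 : ℝ) • innerSL ℝ v) z :=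
      ((innerSL ℝ v).hasFDerivAt.comp z (hasFDerivAt_sub_const w)).const_mul 2
    have dg' : HasFDerivAt (fun z ↦ g' (‖z - w‖ ^ 2)) _ z := hg'.comp_hasFDerivAt z (dsq z)
    rw [first, (dg'.fun_mul dinner).fderiv]
    simp only [add_apply, smul_apply, smul_eq_mul, innerSL_apply_apply,
      real_inner_self_eq_norm_sq, real_inner_comm v, nsmul_eq_mul, Nat.cast_ofNat]
    ring
  have sum_sq : inner ℝ 1 (z - w) ^ 2 + inner ℝ I (z - w) ^ 2 = ‖z - w‖ ^ 2 := by
    simp only [Complex.inner, ← Complex.normSq_eq_norm_sq, Complex.normSq_apply]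
    simp
    ring
  rw [laplacian_eq_fderiv_fderiv hf, second, second, ← sum_sq, norm_one, Complex.norm_I]
  ring

end Radial

section LogApprox

/-- A smooth approximation of `log ‖w‖`, whose Laplacian is an approximate identity of mass `2π`
as `c → ∞`. -/
noncomputable def logNormApprox (c : ℝ) (w : ℂ) : ℝ := Real.log (‖w‖ ^ 2 + c⁻¹ ^ 2) / 2

/-- The probability density whose rescalings `c² k(c z)` are the normalised Laplacians of the
functions `logNormApprox c`. -/
noncomputable def logNormKernel (w : ℂ) : ℝ := (Real.pi * (1 + ‖w‖ ^ 2) ^ 2)⁻¹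

theorem contDiff_logNormApprox_sub {c : ℝ} (hc : c ≠ 0) (ρ : ℂ) :
    ContDiff ℝ 2 fun z ↦ logNormApprox c (z - ρ) := by
  refine (ContDiff.log ?_ fun z ↦ by positivity).div_const 2
  exact ((contDiff_id.sub contDiff_const).norm_sq ℝ).add contDiff_const

theorem laplacian_logNormApprox_sub {c : ℝ} (hc : c ≠ 0) (ρ z : ℂ) :
    Δ (fun z ↦ logNormApprox c (z - ρ)) z =
      2 * Real.pi * (c ^ 2 * logNormKernel (c • (ρ - z))) := by
  set e : ℝ := c⁻¹ ^ 2 with he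
  have e_pos : 0 < e := by positivity
  have dlog {t : ℝ} (ht : 0 ≤ t) : HasDerivAt (fun t ↦ Real.log (t + e) / 2) ((t + e)⁻¹ / 2) t := by
    simpa using (((hasDerivAt_id t).add_const e).log (by positivity)).div_const 2
  have dinv {t : ℝ} (ht : 0 < t + e) :
      HasDerivAt (fun t ↦ (t + e)⁻¹ / 2) (-((t + e) ^ 2)⁻¹ / 2) t := by
    simpa [neg_div] using (((hasDerivAt_id t).add_const e).inv ht.ne').div_const 2
  have laplacian : Δ (fun z ↦ logNormApprox c (z - ρ)) z =
      4 * ((‖z - ρ‖ ^ 2 + e)⁻¹ / 2 + ‖z - ρ‖ ^ 2 * (-((‖z - ρ‖ ^ 2 + e) ^ 2)⁻¹ / 2)) :=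
    laplacian_comp_sq_norm_sub (g := fun t ↦ Real.log (t + e) / 2) (g' := fun t ↦ (t + e)⁻¹ / 2)
      (contDiff_logNormApprox_sub hc ρ).contDiffAt (fun t ht ↦ dlog ht)
      (dinv (by positivity))
  rw [laplacian, logNormKernel, norm_smul, norm_sub_rev ρ z, mul_pow,
    Real.norm_eq_abs, sq_abs]
  have : 0 < ‖z - ρ‖ ^ 2 + e := by positivity
  have : c ^ 2 = e⁻¹ := by simp [he]
  rw [this]
  field_simp
  ring

theorem integral_logNormKernel : ∫ w, logNormKernel w = 1 := by
  have radial : ∫ y in Ioi (0 : ℝ), y * ((1 + y ^ 2) ^ 2)⁻¹ = 1 / 2 := by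
    have hd (y : ℝ) (_ : y ∈ Ici (0 : ℝ)) :
        HasDerivAt (fun y : ℝ ↦ -(1 + y ^ 2)⁻¹ / 2) (y * ((1 + y ^ 2) ^ 2)⁻¹) y := by
      refine ((((hasDerivAt_pow 2 y).const_add 1).fun_inv
        (by positivity)).fun_neg.div_const 2).congr_deriv ?_
      norm_num
      ring
    have hlim : Tendsto (fun y : ℝ ↦ -(1 + y ^ 2)⁻¹ / 2) atTop (𝓝 0) := by
      have := (tendsto_atTop_add_const_left atTop (1 : ℝ)
        (tendsto_pow_atTop (α := ℝ) two_ne_zero)).inv_tendsto_atTop.neg.div_const 2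
      simpa using this
    rw [integral_Ioi_of_hasDerivAt_of_nonneg' hd (fun y (hy : 0 < y) ↦ by positivity) hlim]
    norm_num
  have volume_ball : volume.real (ball (0 : ℂ) 1) = Real.pi := by
    simp [measureReal_def]
  unfold logNormKernel
  rw [integral_fun_norm_addHaar volume fun r ↦ (Real.pi * (1 + r ^ 2) ^ 2)⁻¹]
  simp_rw [mul_inv, Complex.finrank_real_complex, smul_eq_mul, volume_ball]
  have : ∀ y : ℝ, y ^ (2 - 1) * (Real.pi⁻¹ * ((1 + y ^ 2) ^ 2)⁻¹) =
    Real.pi⁻¹ * (y * ((1 + y ^ 2) ^ 2)⁻¹) := fun y ↦ by ring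
  simp_rw [this, integral_const_mul, radial]
  field_simp
  norm_num

theorem tendsto_integral_logNormKernel_smul {w : ℂ → ℝ} {ρ : ℂ} (hw : Integrable w)
    (hρ : ContinuousAt w ρ) :
    Tendsto (fun c : ℝ ↦ ∫ z, c ^ 2 * logNormKernel (c • (ρ - z)) * w z) atTop (𝓝 (w ρ)) := by
  have decay : Tendsto (fun x : ℂ ↦ ‖x‖ ^ Module.finrank ℝ ℂ * logNormKernel x)
      (Bornology.cobounded ℂ) (𝓝 0) := by
    refine squeeze_zero (fun x ↦ by unfold logNormKernel; positivity) (fun x ↦ ?_)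
      (tendsto_inv_atTop_zero.comp tendsto_norm_cobounded_atTop)
    rw [logNormKernel, Function.comp_apply, Complex.finrank_real_complex]
    rcases (norm_nonneg x).eq_or_lt with h | h
    · simp [← h]
    · rw [← div_eq_mul_inv, div_le_iff₀ (by positivity), inv_mul_eq_div, le_div_iff₀ h]
      nlinarith [Real.pi_gt_three, pow_pos h 3, pow_pos h 4, sq_nonneg (‖x‖ - 1),
        sq_nonneg (‖x‖ ^ 2 - ‖x‖), sq_nonneg ((1 + ‖x‖ ^ 2))]
  simpa using tendsto_integral_comp_smul_smul_of_integrable'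
    (fun x ↦ by unfold logNormKernel; positivity) integral_logNormKernel decay hw hρ

theorem abs_logNormApprox_le {c : ℝ} (hc : 1 ≤ c) {w : ℂ} (hw : w ≠ 0) :
    |logNormApprox c w| ≤ |Real.log ‖w‖| + |logNormApprox 1 w| := by
  have := norm_pos_iff.2 hw
  have lower : Real.log ‖w‖ ≤ logNormApprox c w := by
    have := Real.log_le_log (by positivity) (le_add_of_nonneg_right (sq_nonneg c⁻¹) :
      ‖w‖ ^ 2 ≤ ‖w‖ ^ 2 + c⁻¹ ^ 2)
    rw [Real.log_pow] at this
    unfold logNormApprox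
    push_cast at this
    linarith
  have upper : logNormApprox c w ≤ logNormApprox 1 w := by
    unfold logNormApprox
    gcongr
  exact (abs_le_max_abs_abs lower upper).trans
    (max_le_add_of_nonneg (abs_nonneg _) (abs_nonneg _))

theorem tendsto_logNormApprox {w : ℂ} (hw : w ≠ 0) :
    Tendsto (fun c ↦ logNormApprox c w) atTop (𝓝 (Real.log ‖w‖)) := by
  have := norm_pos_iff.2 hw
  have : Tendsto (fun c : ℝ ↦ ‖w‖ ^ 2 + c⁻¹ ^ 2) atTop (𝓝 (‖w‖ ^ 2)) := by
    simpa using (tendsto_inv_atTop_zero.pow 2).const_add (‖w‖ ^ 2)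
  simpa [logNormApprox, Real.log_pow] using (this.log (by positivity)).div_const 2

theorem tendsto_integral_logNormApprox_mul {α : Type*} [MeasurableSpace α] {μ : Measure α}
    {p : α → ℂ} {w : α → ℝ} (hp : Measurable p) (hne : ∀ᵐ x ∂μ, p x ≠ 0)
    (hw : AEStronglyMeasurable w μ)
    (hlog : Integrable (fun x ↦ Real.log ‖p x‖ * w x) μ)
    (hone : Integrable (fun x ↦ logNormApprox 1 (p x) * w x) μ) :
    Tendsto (fun c ↦ ∫ x, logNormApprox c (p x) * w x ∂μ) atTop
      (𝓝 (∫ x, Real.log ‖p x‖ * w x ∂μ)) := by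
  refine tendsto_integral_filter_of_dominated_convergence
    (fun x ↦ ‖Real.log ‖p x‖ * w x‖ + ‖logNormApprox 1 (p x) * w x‖) ?_ ?_
    (hlog.norm.add hone.norm) ?_
  · refine .of_forall fun c ↦ AEStronglyMeasurable.mul ?_ hw
    exact (((hp.norm.pow_const 2).add_const _).log.div_const 2).aestronglyMeasurable
  · filter_upwards [eventually_ge_atTop 1] with c hc
    filter_upwards [hne] with x hx
    simp_rw [norm_mul, ← add_mul]
    gcongr
    exact abs_logNormApprox_le hc hx
  · filter_upwards [hne] with x hx
    exact (tendsto_logNormApprox hx).mul_const _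

theorem locallyIntegrable_log_norm : LocallyIntegrable fun z : ℂ ↦ Real.log ‖z‖ := by
  refine locallyIntegrable_iff.2 fun K hK ↦ ?_
  obtain ⟨R, hR⟩ := hK.isBounded.subset_closedBall (0 : ℂ)
  have radial : IntegrableOn (fun r : ℝ ↦ r ^ (Module.finrank ℝ ℂ - 1) •
      (Iic R).indicator Real.log r) (Ioi 0) := by
    have h : IntegrableOn (fun r : ℝ ↦ r * Real.log r) (Ioc 0 R) :=
      (Real.continuous_mul_log.integrableOn_Icc (a := 0) (b := R)).mono_set Ioc_subset_Icc_self
    rw [← Ioi_inter_Iic, inter_comm, IntegrableOn,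
      ← Measure.restrict_restrict measurableSet_Iic, ← IntegrableOn,
      ← integrable_indicator_iff measurableSet_Iic] at h
    exact h.congr (.of_forall fun r ↦ by simp [indicator_apply])
  have := (integrable_fun_norm_addHaar (volume : Measure ℂ)).2 radial
  refine (this.integrableOn (s := K)).congr_fun (fun z hz ↦ ?_) hK.measurableSet
  exact indicator_of_mem (by simpa using hR hz) _

theorem integrable_log_norm_sub_mul (ρ : ℂ) {g : ℂ → ℝ} (hg : Continuous g)
    (hc : HasCompactSupport g) : Integrable fun z ↦ Real.log ‖z - ρ‖ * g z := by
  have := (locallyIntegrable_log_norm.integrable_smul_right_of_hasCompactSupport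
    (hg.comp (continuous_add_const ρ))
    (hc.comp_homeomorph (Homeomorph.addRight ρ))).comp_sub_right ρ
  simpa using this

theorem locallyIntegrable_log_norm_of_meromorphicOn {E : Type*} [NormedAddCommGroup E]
    [NormedSpace ℝ E] {f : ℝ → E} (hf : MeromorphicOn f univ) :
    LocallyIntegrable fun x ↦ Real.log ‖f x‖ := by
  refine locallyIntegrable_iff.2 fun K hK ↦ ?_
  obtain ⟨R, hR⟩ := hK.isBounded.subset_closedBall (0 : ℝ)
  rw [Real.closedBall_eq_Icc] at hR
  exact (((hf.mono_set (subset_univ _)).intervalIntegrable_log_norm).1.congr_set_ae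
    Ioc_ae_eq_Icc.symm).mono_set hR

variable {a : ℝ} {φ : ℂ → ℝ}

theorem integrable_log_norm_sub_mul_fderiv (hφ : IsTestFunction a φ) (ρ : ℂ) :
    Integrable fun y : ℝ ↦ Real.log ‖a + y * I - ρ‖ * fderiv ℝ φ (a + y * I) 1 := by
  have hemb := isClosedEmbedding_add_mul_I a
  refine LocallyIntegrable.integrable_smul_right_of_hasCompactSupport
    (locallyIntegrable_log_norm_of_meromorphicOn fun y _ ↦ ?_)
    ((hφ.continuous_fderiv_apply 1).comp hemb.continuous)
    ((hφ.hasCompactSupport.fderiv_apply ℝ 1).comp_isClosedEmbedding hemb)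
  exact ((analyticAt_const.add ((Complex.ofRealCLM.analyticAt y).mul analyticAt_const)).sub
    analyticAt_const).meromorphicAt

theorem GreenIdentity.logNormApprox_sub (hφ : IsTestFunction a φ) (ρ : ℂ) {c : ℝ} (hc : 0 < c) :
    GreenIdentity a φ (fun z ↦ logNormApprox c (z - ρ)) (2 * Real.pi *
      ∫ z, c ^ 2 * logNormKernel (c • (ρ - z)) * {z : ℂ | a < z.re}.indicator φ z) := by
  convert GreenIdentity.of_contDiff hφ (contDiff_logNormApprox_sub hc.ne' ρ) using 1
  rw [← integral_const_mul, ← integral_indicator (measurableSet_halfPlane a)]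
  refine integral_congr_ae (.of_forall fun z ↦ ?_)
  simp only [indicator_apply, laplacian_logNormApprox_sub hc.ne']
  split_ifs <;> ring

theorem GreenIdentity.log_norm_sub (hφ : IsTestFunction a φ) (ρ : ℂ) :
    GreenIdentity a φ (fun z ↦ Real.log ‖z - ρ‖)
      (2 * Real.pi * {z : ℂ | a < z.re}.indicator φ ρ) := by
  have line := integrable_log_norm_sub_mul_fderiv hφ ρ
  have plane : Integrable fun z ↦ Real.log ‖z - ρ‖ * Δ φ z :=
    integrable_log_norm_sub_mul ρ (continuous_laplacian hφ.contDiff) hφ.hasCompactSupport_laplacian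
  have indicator_integrable : Integrable ({z : ℂ | a < z.re}.indicator φ) :=
    (hφ.contDiff.continuous.integrable_of_hasCompactSupport hφ.hasCompactSupport).indicator
      (measurableSet_halfPlane a)
  have lim_line : Tendsto (fun c ↦ ∫ y : ℝ, logNormApprox c (a + y * I - ρ) *
      fderiv ℝ φ (a + y * I) 1) atTop
      (𝓝 (∫ y : ℝ, Real.log ‖a + y * I - ρ‖ * fderiv ℝ φ (a + y * I) 1)) := by
    refine tendsto_integral_logNormApprox_mul (by fun_prop) ?_
      ((hφ.continuous_fderiv_apply 1).comp
        (isClosedEmbedding_add_mul_I a).continuous).aestronglyMeasurable line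
      (hφ.integrable_mul_fderiv (contDiff_logNormApprox_sub one_ne_zero ρ).continuous)
    filter_upwards [Measure.ae_ne volume ρ.im] with y hy h
    exact hy (by simpa using congrArg Complex.im (sub_eq_zero.1 h))
  have lim_plane : Tendsto (fun c ↦ ∫ z in {z : ℂ | a < z.re}, logNormApprox c (z - ρ) * Δ φ z)
      atTop (𝓝 (∫ z in {z : ℂ | a < z.re}, Real.log ‖z - ρ‖ * Δ φ z)) := by
    refine tendsto_integral_logNormApprox_mul (by fun_prop)
      (ae_restrict_of_ae ?_) (continuous_laplacian hφ.contDiff).aestronglyMeasurable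
      plane.integrableOn (hφ.integrable_mul_laplacian
        (contDiff_logNormApprox_sub one_ne_zero ρ).continuous).integrableOn
    filter_upwards [Measure.ae_ne volume ρ] with z hz using sub_ne_zero.2 hz
  refine ⟨line, plane.integrableOn, tendsto_nhds_unique (lim_line.add lim_plane) ?_⟩
  refine ((tendsto_integral_logNormKernel_smul indicator_integrable
    hφ.continuous_indicator.continuousAt).const_mul (2 * Real.pi)).congr' ?_
  filter_upwards [eventually_gt_atTop 0] with c hc
  exact (GreenIdentity.logNormApprox_sub hφ ρ hc).integral_add_setIntegral.symm

end LogApprox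

section LogNorm

variable {f : ℂ → ℂ}

theorem exists_log_norm_eq_sum_add {K : Set ℂ} (hK : IsCompact K) (hf : AnalyticOnNhd ℂ f K)
    (horder : ∀ z ∈ K, analyticOrderAt f z ≠ ⊤) :
    ∃ (S : Finset ℂ) (g : ℂ → ℂ), (∀ z ∈ K, z ∉ S → analyticOrderNatAt f z = 0) ∧
      AnalyticOnNhd ℂ g K ∧ (∀ z ∈ K, g z ≠ 0) ∧ {z ∈ K | Real.log ‖f z‖ ≠
        ∑ ρ ∈ S, analyticOrderNatAt f ρ * Real.log ‖z - ρ‖ + Real.log ‖g z‖}.Finite := by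
  have order_eq {z : ℂ} (hz : z ∈ K) :
      meromorphicOrderAt f z = (analyticOrderNatAt f z : ℤ) := by
    rw [(hf z hz).meromorphicOrderAt_eq, ← Nat.cast_analyticOrderNatAt (horder z hz)]
    rfl
  have divisor_eq {z : ℂ} (hz : z ∈ K) :
      MeromorphicOn.divisor f K z = analyticOrderNatAt f z := by
    rw [MeromorphicOn.divisor_apply hf.meromorphicOn hz, order_eq hz, WithTop.untop₀_coe]
  have finite : (MeromorphicOn.divisor f K).support.Finite :=
    (MeromorphicOn.divisor f K).finiteSupport hK
  have support_subset := (MeromorphicOn.divisor f K).supportWithinDomain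
  obtain ⟨g, hg, hg_ne, hfg⟩ := hf.meromorphicOn.extract_zeros_poles
    (fun z ↦ by rw [order_eq z.2]; exact WithTop.coe_ne_top) finite
  refine ⟨finite.toFinset, g, fun z hz hz' ↦ ?_, hg,
    fun z hz ↦ hg_ne ⟨z, hz⟩, ?_⟩
  · have : MeromorphicOn.divisor f K z = 0 := by simpa using hz'
    exact_mod_cast (divisor_eq hz).symm.trans this
  · refine (hK.finite_sdiff_of_mem_codiscreteWithin
      (MeromorphicOn.extract_zeros_poles_log hg_ne hfg)).subset fun z hz ↦ ⟨hz.1, fun h ↦ hz.2 ?_⟩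
    rw [show Real.log ‖f z‖ = _ from h, finsum_eq_sum_of_support_subset (s := finite.toFinset)]
    · simp only [Pi.add_apply, Finset.sum_apply]
      congr 1
      refine Finset.sum_congr rfl fun ρ hρ ↦ ?_
      rw [divisor_eq (support_subset (finite.mem_toFinset.1 hρ)), Int.cast_natCast]
    · intro ρ hρ
      rw [finite.coe_toFinset]
      intro h
      refine hρ ?_
      ext z
      simp [h]

theorem GreenIdentity.log_norm {a : ℝ} {φ : ℂ → ℝ} (hφ : IsTestFunction a φ)
    (hf : AnalyticOnNhd ℂ f (tsupport φ ∩ {z | a ≤ z.re}))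
    (horder : ∀ z ∈ tsupport φ ∩ {z | a ≤ z.re}, analyticOrderAt f z ≠ ⊤) :
    GreenIdentity a φ (fun z ↦ Real.log ‖f z‖)
      (2 * Real.pi * ∑ᶠ ρ, analyticOrderNatAt f ρ * {z : ℂ | a < z.re}.indicator φ ρ) := by
  set K : Set ℂ := tsupport φ ∩ {z | a ≤ z.re}
  have mem_K {z : ℂ} (hre : a ≤ z.re) (hz : z ∈ tsupport φ) : z ∈ K := ⟨hz, hre⟩
  obtain ⟨S, g, hS, hg, hg_ne, exceptional⟩ := exists_log_norm_eq_sum_add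
    (hφ.hasCompactSupport.isCompact.inter_right
      (isClosed_le continuous_const Complex.continuous_re)) hf horder
  have mass : 2 * Real.pi * ∑ᶠ ρ, analyticOrderNatAt f ρ * {z : ℂ | a < z.re}.indicator φ ρ =
      ∑ ρ ∈ S, analyticOrderNatAt f ρ *
        (2 * Real.pi * {z : ℂ | a < z.re}.indicator φ ρ) + 0 := by
    rw [finsum_eq_sum_of_support_subset (s := S), add_zero, Finset.mul_sum]
    · exact Finset.sum_congr rfl fun ρ _ ↦ by ring
    · refine fun ρ hρ ↦ by_contra fun h ↦ hρ ?_
      by_cases hρK : ρ ∈ K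
      · simp [hS ρ hρK h]
      · refine mul_eq_zero_of_right _ (indicator_apply_eq_zero.2 fun hre ↦ ?_)
        exact image_eq_zero_of_notMem_tsupport fun hz ↦ hρK (mem_K (show a < ρ.re from hre).le hz)
  have factorised : GreenIdentity a φ
      (fun z ↦ ∑ ρ ∈ S, analyticOrderNatAt f ρ * Real.log ‖z - ρ‖ + Real.log ‖g z‖)
      (∑ ρ ∈ S, analyticOrderNatAt f ρ * (2 * Real.pi * {z : ℂ | a < z.re}.indicator φ ρ) + 0) :=
    (GreenIdentity.sum _ fun ρ _ ↦ (GreenIdentity.log_norm_sub hφ ρ).const_mul _).add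
      (.of_harmonicOnNhd hφ fun z hz ↦ (hg z hz).harmonicAt_log_norm (hg_ne z hz))
  rw [mass]
  refine factorised.congr_ae ?_ ?_
  · filter_upwards [(exceptional.preimage
      (isClosedEmbedding_add_mul_I a).injective.injOn).countable.ae_notMem volume] with y hy hφy
    refine (not_not.1 fun h ↦ hy ⟨mem_K (by simp) ?_, h⟩).symm
    exact support_fderiv_subset ℝ fun h ↦ hφy (by rw [h]; rfl)
  · filter_upwards [exceptional.countable.ae_notMem volume] with z hz hre hφz
    refine (not_not.1 fun h ↦ hz ⟨mem_K hre.le ?_, h⟩).symm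
    exact not_imp_comm.1 laplacian_eq_zero_of_notMem_tsupport hφz

end LogNorm

section Jensen

theorem integrableOn_log_norm {f : ℂ → ℂ} {K : Set ℂ} (hK : IsCompact K)
    (hf : AnalyticOnNhd ℂ f K) (horder : ∀ z ∈ K, analyticOrderAt f z ≠ ⊤) :
    IntegrableOn (fun z ↦ Real.log ‖f z‖) K := by
  obtain ⟨S, g, -, hg, hg_ne, exceptional⟩ := exists_log_norm_eq_sum_add hK hf horder
  have log_sub (ρ : ℂ) : IntegrableOn (fun z ↦ Real.log ‖z - ρ‖) K := by
    have := (locallyIntegrable_log_norm.integrableOn_isCompact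
      (hK.image (continuous_sub_right ρ))).integrable_indicator
        (hK.image (continuous_sub_right ρ)).measurableSet
    rw [← integrable_indicator_iff hK.measurableSet]
    refine (this.comp_sub_right ρ).congr (.of_forall fun z ↦ ?_)
    by_cases hz : z ∈ K <;> simp [hz]
  have factorised : IntegrableOn (fun z ↦
      ∑ ρ ∈ S, analyticOrderNatAt f ρ * Real.log ‖z - ρ‖ + Real.log ‖g z‖) K :=
    (integrable_finsetSum S fun ρ _ ↦ (log_sub ρ).const_mul _).add
      ((hg.continuousOn.norm.log fun z hz ↦ norm_ne_zero_iff.2 (hg_ne z hz)).integrableOn_compact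
        hK)
  refine factorised.congr_fun_ae ?_
  filter_upwards [ae_restrict_mem hK.measurableSet,
    ae_restrict_of_ae (exceptional.countable.ae_notMem volume)] with z hzK hz
  exact (not_not.1 fun h ↦ hz ⟨hzK, h⟩).symm

section Polar

variable {E : Type*} [NormedAddCommGroup E] [NormedSpace ℝ E] {u : ℂ → E}

theorem add_polarCoord_symm_eq_circleMap (c : ℂ) (p : ℝ × ℝ) :
    c + ((polarCoord.symm p).1 + (polarCoord.symm p).2 * I) = circleMap c p.1 p.2 := by
  simp only [polarCoord_symm_apply, circleMap, Complex.exp_mul_I]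
  push_cast
  ring

theorem integrableOn_smul_comp_circleMap (hu : Integrable u) (c : ℂ) :
    IntegrableOn (fun p : ℝ × ℝ ↦ p.1 • u (circleMap c p.1 p.2))
      (Ioi 0 ×ˢ Ioo (-Real.pi) Real.pi) := by
  have := (integrableOn_image_iff_integrableOn_abs_det_fderiv_smul volume
    polarCoord.open_target.measurableSet
    (fun p _ ↦ (hasFDerivAt_polarCoord_symm p).hasFDerivWithinAt) polarCoord.symm.injOn _).1
    (integrable_comp_re_add_im (hu.comp_add_left c)).integrableOn
  refine this.congr_fun (fun p hp ↦ ?_) polarCoord.open_target.measurableSet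
  simp only [det_fderivPolarCoordSymm, abs_of_pos (mem_Ioi.1 hp.1),
    add_polarCoord_symm_eq_circleMap]

theorem setIntegral_smul_comp_circleMap (u : ℂ → E) (c : ℂ) (r : ℝ) :
    ∫ θ in Ioo (-Real.pi) Real.pi, r • u (circleMap c r θ) =
      (2 * Real.pi * r) • Real.circleAverage u c r := by
  have periodic : Function.Periodic (fun θ ↦ u (circleMap c r θ)) (2 * Real.pi) :=
    (periodic_circleMap c r).comp u
  have shift := periodic.intervalIntegral_add_eq (-Real.pi) 0
  rw [show -Real.pi + 2 * Real.pi = Real.pi by ring, zero_add] at shift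
  rw [integral_smul, ← integral_Ioc_eq_integral_Ioo,
    ← intervalIntegral.integral_of_le (by linarith [Real.pi_pos]), shift,
    Real.circleAverage_def, smul_smul]
  congr 1
  field_simp

theorem integrableOn_smul_circleAverage (hu : Integrable u) (c : ℂ) :
    IntegrableOn (fun r ↦ (2 * Real.pi * r) • Real.circleAverage u c r) (Ioi 0) := by
  have planar := integrableOn_smul_comp_circleMap hu c
  rw [IntegrableOn, Measure.volume_eq_prod, ← Measure.prod_restrict] at planar
  simpa only [setIntegral_smul_comp_circleMap] using! planar.integral_prod_left

theorem integral_eq_setIntegral_smul_circleAverage (hu : Integrable u) (c : ℂ) :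
    ∫ z, u z = ∫ r in Ioi 0, (2 * Real.pi * r) • Real.circleAverage u c r := by
  have fubini := setIntegral_prod _ (integrableOn_smul_comp_circleMap hu c)
  simp only [setIntegral_smul_comp_circleMap] at fubini
  rw [← fubini, ← integral_add_left_eq_self u c, ← Complex.integral_comp_polarCoord_symm]
  refine setIntegral_congr_fun (measurableSet_Ioi.prod measurableSet_Ioo) fun p _ ↦ ?_
  simp only [← add_polarCoord_symm_eq_circleMap, Complex.polarCoord_symm_apply,
    polarCoord_symm_apply]
  push_cast
  ring_nf

end Polar

theorem circleAverage_indicator_ball (u : ℂ → ℝ) (c : ℂ) {R r : ℝ} (hr : 0 < r) :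
    Real.circleAverage ((ball c R).indicator u) c r =
      (Iio R).indicator (Real.circleAverage u c) r := by
  have mem_ball_iff {z : ℂ} (hz : z ∈ sphere c |r|) : z ∈ ball c R ↔ r ∈ Iio R := by
    rw [mem_ball, mem_sphere.1 hz, abs_of_pos hr, mem_Iio]
  by_cases h : r ∈ Iio R
  · rw [indicator_of_mem h]
    exact Real.circleAverage_congr_sphere fun z hz ↦ indicator_of_mem ((mem_ball_iff hz).2 h) u
  · rw [indicator_of_notMem h]
    exact (Real.circleAverage_congr_sphere fun z hz ↦
      indicator_of_notMem (mt (mem_ball_iff hz).1 h) u).trans (Real.circleAverage_const 0 c r)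

theorem pi_mul_sq_mul_le_setIntegral_ball {u : ℂ → ℝ} {c : ℂ} {R m : ℝ} (hR : 0 ≤ R)
    (hu : IntegrableOn u (ball c R)) (hm : ∀ r ∈ Ioo 0 R, m ≤ Real.circleAverage u c r) :
    Real.pi * R ^ 2 * m ≤ ∫ z in ball c R, u z := by
  have hv : Integrable ((ball c R).indicator u) := hu.integrable_indicator measurableSet_ball
  have radial : ∫ r in Ioc 0 R, 2 * Real.pi * r * m = Real.pi * R ^ 2 * m := by
    rw [← intervalIntegral.integral_of_le hR]
    rw [intervalIntegral.integral_mul_const, intervalIntegral.integral_const_mul, integral_id]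
    ring
  rw [← radial, ← integral_indicator measurableSet_ball,
    integral_eq_setIntegral_smul_circleAverage hv c, integral_Ioc_eq_integral_Ioo,
    ← Ioi_inter_Iio, ← setIntegral_indicator measurableSet_Iio]
  refine setIntegral_mono_on ?_ (integrableOn_smul_circleAverage hv c) measurableSet_Ioi
    fun r hr ↦ ?_
  · rw [IntegrableOn, integrable_indicator_iff measurableSet_Iio, IntegrableOn,
      Measure.restrict_restrict measurableSet_Iio, inter_comm, Ioi_inter_Iio]
    exact ((by fun_prop : Continuous fun r : ℝ ↦ 2 * Real.pi * r * m).integrableOn_Icc).mono_set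
      Ioo_subset_Icc_self
  · rw [circleAverage_indicator_ball u c hr, smul_eq_mul]
    by_cases h : r ∈ Iio R
    · rw [indicator_of_mem h, indicator_of_mem h]
      have := hm r ⟨hr, h⟩
      have := mem_Ioi.1 hr
      gcongr
    · rw [indicator_of_notMem h, indicator_of_notMem h, mul_zero]

theorem log_norm_le_circleAverage {f : ℂ → ℂ} {c : ℂ} {R : ℝ} (hR : 0 < R)
    (hf : AnalyticOnNhd ℂ f (closedBall c R)) (hc : f c ≠ 0) :
    Real.log ‖f c‖ ≤ Real.circleAverage (fun z ↦ Real.log ‖f z‖) c R := by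
  have hf' : AnalyticOnNhd ℂ f (closedBall c |R|) := by rwa [abs_of_pos hR]
  rw [hf'.circleAverage_log_norm hR.ne' hc]
  refine le_add_of_nonneg_left (finsum_nonneg fun ρ ↦ ?_)
  by_cases hρ : ρ ∈ closedBall c |R|
  · refine mul_nonneg (mod_cast MeromorphicOn.AnalyticOnNhd.divisor_nonneg hf' ρ) ?_
    rw [abs_of_pos hR, mem_closedBall', dist_eq_norm] at hρ
    rcases eq_or_ne ρ c with rfl | hne
    · simp
    · refine Real.log_nonneg ?_
      rw [← div_eq_mul_inv, one_le_div (norm_pos_iff.2 (sub_ne_zero.2 hne.symm))]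
      exact hρ
  · simp [hρ]

theorem integrableOn_log_norm_closedBall {f : ℂ → ℂ} {c : ℂ} {R : ℝ} (hR : 0 ≤ R)
    (hf : AnalyticOnNhd ℂ f (closedBall c R)) (hc : f c ≠ 0) :
    IntegrableOn (fun z ↦ Real.log ‖f z‖) (closedBall c R) := by
  have hc_mem : c ∈ closedBall c R := mem_closedBall_self hR
  refine integrableOn_log_norm (isCompact_closedBall c R) hf fun z hz ↦ ?_
  exact hf.analyticOrderAt_ne_top_of_isPreconnected (convex_closedBall c R).isPreconnected
    hc_mem hz (by simp [(hf c hc_mem).analyticOrderAt_eq_zero.2 hc])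

theorem setIntegral_abs_log_norm_le {f : ℂ → ℂ} {c : ℂ} {R M : ℝ} (hR : 0 ≤ R) (hM : 0 ≤ M)
    (hf : AnalyticOnNhd ℂ f (closedBall c R)) (hc : f c ≠ 0)
    (hfM : ∀ z ∈ ball c R, Real.log ‖f z‖ ≤ M) :
    ∫ z in ball c R, |Real.log ‖f z‖| ≤ Real.pi * R ^ 2 * (2 * M - Real.log ‖f c‖) := by
  have hint : IntegrableOn (fun z ↦ Real.log ‖f z‖) (ball c R) :=
    (integrableOn_log_norm_closedBall hR hf hc).mono_set ball_subset_closedBall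
  have hconst : IntegrableOn (fun _ ↦ 2 * M) (ball c R) :=
    integrableOn_const measure_ball_lt_top.ne
  have jensen : Real.pi * R ^ 2 * Real.log ‖f c‖ ≤ ∫ z in ball c R, Real.log ‖f z‖ :=
    pi_mul_sq_mul_le_setIntegral_ball hR hint fun r hr ↦
      log_norm_le_circleAverage hr.1 (hf.mono (closedBall_subset_closedBall hr.2.le)) hc
  calc ∫ z in ball c R, |Real.log ‖f z‖|
      ≤ ∫ z in ball c R, (2 * M - Real.log ‖f z‖) := by
        refine setIntegral_mono_on hint.abs (hconst.sub hint) measurableSet_ball fun z hz ↦ ?_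
        exact abs_le.2 ⟨by linarith, by linarith [hfM z hz]⟩
    _ = Real.pi * R ^ 2 * (2 * M) - ∫ z in ball c R, Real.log ‖f z‖ := by
        rw [integral_sub hconst hint, setIntegral_const, Measure.real, Complex.volume_ball]
        simp [hR, mul_comm Real.pi]
    _ ≤ Real.pi * R ^ 2 * (2 * M - Real.log ‖f c‖) := by linarith

end Jensen

section Zeta

/-- The fractional part restricted to `(1, ∞)`. Its Mellin transform continues `ζ` to the left
of the line `re s = 1`. -/
noncomputable def fractIndicator : ℝ → ℂ :=
  (Ioi 1).indicator fun t ↦ ((Int.fract t : ℝ) : ℂ)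

theorem norm_fract_le_one (t : ℝ) : ‖((Int.fract t : ℝ) : ℂ)‖ ≤ 1 := by
  rw [Complex.norm_real, Real.norm_of_nonneg (Int.fract_nonneg t)]
  exact (Int.fract_lt_one t).le

theorem norm_fractIndicator_le (t : ℝ) : ‖fractIndicator t‖ ≤ 1 :=
  (norm_indicator_le_norm_self _ t).trans (norm_fract_le_one t)

theorem measurable_fractIndicator : Measurable fractIndicator :=
  (Complex.measurable_ofReal.comp measurable_fract).indicator measurableSet_Ioi

theorem mellin_fractIndicator_eq (s : ℂ) :
    mellin fractIndicator (-s) =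
      ∫ t in Ioi (1 : ℝ), ((Int.fract t : ℝ) : ℂ) * (t : ℂ) ^ (-(s + 1)) := by
  have integrand_eq (t : ℝ) : (t : ℂ) ^ (-s - 1) • fractIndicator t =
      (Ioi 1).indicator (fun t : ℝ ↦ ((Int.fract t : ℝ) : ℂ) * (t : ℂ) ^ (-(s + 1))) t := by
    by_cases ht : t ∈ Ioi 1
    · rw [fractIndicator, indicator_of_mem ht, indicator_of_mem ht, smul_eq_mul, mul_comm, neg_add']
    · rw [fractIndicator, indicator_of_notMem ht, indicator_of_notMem ht, smul_zero]
  simp_rw [mellin, integrand_eq]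
  rw [setIntegral_indicator measurableSet_Ioi,
    inter_eq_self_of_subset_right (Ioi_subset_Ioi zero_le_one)]

theorem norm_mellin_fractIndicator_le {s : ℂ} (hs : 0 < s.re) :
    ‖mellin fractIndicator (-s)‖ ≤ 1 / s.re := by
  have hexp : -(s.re + 1) < -1 := by linarith
  calc ‖mellin fractIndicator (-s)‖
      ≤ ∫ t in Ioi (1 : ℝ), t ^ (-(s.re + 1)) := by
        rw [mellin_fractIndicator_eq]
        refine norm_integral_le_of_norm_le (integrableOn_Ioi_rpow_of_lt hexp one_pos) ?_
        filter_upwards [ae_restrict_mem measurableSet_Ioi] with t ht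
        have ht0 : 0 < t := one_pos.trans ht
        rw [norm_mul, Complex.norm_cpow_eq_rpow_re_of_pos ht0, Complex.neg_re, Complex.add_re,
          Complex.one_re]
        exact mul_le_of_le_one_left (by positivity) (norm_fract_le_one t)
    _ = 1 / s.re := by
        rw [integral_Ioi_rpow_of_lt hexp one_pos, Real.one_rpow]
        have : -(s.re + 1) + 1 ≠ 0 := by linarith
        field_simp
        ring

theorem differentiableAt_mellin_fractIndicator {s : ℂ} (hs : 0 < s.re) :
    DifferentiableAt ℂ (fun s ↦ mellin fractIndicator (-s)) s := by
  have h : DifferentiableAt ℂ (mellin fractIndicator) (-s) := by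
    refine mellin_differentiableAt_of_isBigO_rpow (a := 0) (b := (-s).re - 1) ?_ ?_ (by simpa) ?_
      (by linarith)
    · refine ((locallyIntegrable_const (1 : ℝ)).mono
        measurable_fractIndicator.aestronglyMeasurable
        (Eventually.of_forall fun t ↦ ?_)).locallyIntegrableOn _
      simpa using norm_fractIndicator_le t
    · refine Asymptotics.IsBigO.of_bound 1 (Eventually.of_forall fun t ↦ ?_)
      simpa using norm_fractIndicator_le t
    · refine Asymptotics.IsBigO.of_bound 1 ?_
      filter_upwards [mem_nhdsWithin_of_mem_nhds (Iio_mem_nhds one_pos)] with t ht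
      rw [fractIndicator, indicator_of_notMem (notMem_Ioi.2 (le_of_lt ht)), norm_zero]
      positivity
  exact h.comp s differentiableAt_id.neg

theorem sum_one_mul_cpow_eq {s : ℂ} {t : ℝ} (ht : 0 < t) :
    (∑ k ∈ Finset.Icc 1 ⌊t⌋₊, (1 : ℕ → ℂ) k) * (t : ℂ) ^ (-(s + 1)) =
      (t : ℂ) ^ (-s) - ((Int.fract t : ℝ) : ℂ) * (t : ℂ) ^ (-(s + 1)) := by
  have floor_eq : (⌊t⌋₊ : ℂ) = t - ((Int.fract t : ℝ) : ℂ) := by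
    rw [← Complex.ofReal_sub, Int.self_sub_fract, ← natCast_floor_eq_intCast_floor ht.le,
      Complex.ofReal_natCast]
  have cpow_eq : (t : ℂ) ^ (-s) = t * (t : ℂ) ^ (-(s + 1)) := by
    rw [show -s = 1 + -(s + 1) by ring, Complex.cpow_add _ _ (by exact_mod_cast ht.ne'),
      Complex.cpow_one]
  simp only [Pi.one_apply, Finset.sum_const, Nat.card_Icc, add_tsub_cancel_right, nsmul_eq_mul,
    mul_one]
  rw [floor_eq, cpow_eq]
  ring

theorem integrableOn_fract_mul_cpow {s : ℂ} (hs : 0 < s.re) :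
    IntegrableOn (fun t : ℝ ↦ ((Int.fract t : ℝ) : ℂ) * (t : ℂ) ^ (-(s + 1))) (Ioi 1) := by
  have hexp : (-(s + 1)).re < -1 := by simpa
  exact (integrableOn_Ioi_cpow_of_lt hexp one_pos).bdd_mul (c := 1)
    (Complex.measurable_ofReal.comp measurable_fract).aestronglyMeasurable
    (Eventually.of_forall norm_fract_le_one)

theorem riemannZeta_eq_sub_mul_mellin {s : ℂ} (hs : 1 < s.re) :
    riemannZeta s = s / (s - 1) - s * mellin fractIndicator (-s) := by
  have hs1 : s - 1 ≠ 0 := sub_ne_zero.2 (by rintro rfl; simp at hs)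
  have hs1' : -s + 1 ≠ 0 := by rwa [neg_add_eq_sub, ← neg_sub, neg_ne_zero]
  have hexp : (-s).re < -1 := by simpa using hs
  have partialSum_isBigO : (fun n : ℕ ↦ ∑ k ∈ Finset.Icc 1 n, ‖(1 : ℕ → ℂ) k‖) =O[atTop]
      fun n ↦ (n : ℝ) ^ (1 : ℝ) :=
    Asymptotics.IsBigO.of_bound 1 (Eventually.of_forall fun n ↦ by simp)
  calc riemannZeta s
      = s * ∫ t in Ioi (1 : ℝ),
          (∑ k ∈ Finset.Icc 1 ⌊t⌋₊, (1 : ℕ → ℂ) k) * (t : ℂ) ^ (-(s + 1)) := by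
        rw [← LSeries_one_eq_riemannZeta hs,
          LSeries_eq_mul_integral' 1 zero_le_one hs partialSum_isBigO]
    _ = s * ∫ t in Ioi (1 : ℝ),
          ((t : ℂ) ^ (-s) - ((Int.fract t : ℝ) : ℂ) * (t : ℂ) ^ (-(s + 1))) := by
        rw [setIntegral_congr_fun measurableSet_Ioi fun t ht ↦
          sum_one_mul_cpow_eq (one_pos.trans (mem_Ioi.1 ht))]
    _ = s / (s - 1) - s * mellin fractIndicator (-s) := by
        rw [integral_sub (integrableOn_Ioi_cpow_of_lt hexp one_pos)
          (integrableOn_fract_mul_cpow (one_pos.trans hs)), integral_Ioi_cpow_of_lt hexp one_pos,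
          ← mellin_fractIndicator_eq, Complex.ofReal_one, Complex.one_cpow]
        field_simp
        ring

theorem riemannZeta₁_eq_sub_mul_mellin {s : ℂ} (hs : 0 < s.re) :
    riemannZeta₁ s = s - s * (s - 1) * mellin fractIndicator (-s) := by
  have isOpen_re (a : ℝ) : IsOpen {s : ℂ | a < s.re} :=
    isOpen_lt continuous_const Complex.continuous_re
  have lhs_analytic : AnalyticOnNhd ℂ riemannZeta₁ {s : ℂ | 0 < s.re} :=
    differentiable_riemannZeta₁.differentiableOn.analyticOnNhd (isOpen_re 0)
  have rhs_analytic : AnalyticOnNhd ℂ (fun s ↦ s - s * (s - 1) * mellin fractIndicator (-s))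
      {s : ℂ | 0 < s.re} := by
    refine DifferentiableOn.analyticOnNhd
      (fun s hs ↦ DifferentiableAt.differentiableWithinAt ?_) (isOpen_re 0)
    have := differentiableAt_mellin_fractIndicator hs
    fun_prop
  refine lhs_analytic.eqOn_of_preconnected_of_eventuallyEq rhs_analytic
    (convex_halfSpace_re_gt 0).isPreconnected (z₀ := 2) (by simp) ?_ hs
  filter_upwards [(isOpen_re 1).mem_nhds (by simp : (2 : ℂ) ∈ {s : ℂ | 1 < s.re})] with s hs
  have hs1 : s ≠ 1 := by rintro rfl; simp at hs
  have hzeta := riemannZeta_eq_inv_sub_mul hs1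
  rw [riemannZeta_eq_sub_mul_mellin hs] at hzeta
  have := sub_ne_zero.2 hs1
  field_simp at hzeta
  rw [← hzeta]
  ring

/-- The function `ζ(s) (s - 1) / s`, without the removable singularity at `1`. It is holomorphic
for `re s > 0`, with the modulus of `ζ` on the critical line and the value `1` at `1`. -/
noncomputable def zetaBlaschke (s : ℂ) : ℂ := riemannZeta₁ s / s

theorem zetaBlaschke_one : zetaBlaschke 1 = 1 := by simp [zetaBlaschke]

theorem analyticAt_zetaBlaschke {s : ℂ} (hs : s ≠ 0) : AnalyticAt ℂ zetaBlaschke s :=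
  (differentiable_riemannZeta₁.analyticAt s).div analyticAt_id hs

theorem zetaBlaschke_eq {s : ℂ} (hs : s ≠ 1) : zetaBlaschke s = (s - 1) / s * riemannZeta s := by
  rw [riemannZeta_eq_inv_sub_mul hs, zetaBlaschke]
  have := sub_ne_zero.2 hs
  field_simp

theorem norm_zetaBlaschke_sub_one_le {s : ℂ} (hs : 0 < s.re) :
    ‖zetaBlaschke s - 1‖ ≤ ‖s - 1‖ / s.re := by
  have h0 : s ≠ 0 := by rintro rfl; simp at hs
  have hsub : zetaBlaschke s - 1 = -((s - 1) * mellin fractIndicator (-s)) := by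
    rw [zetaBlaschke, riemannZeta₁_eq_sub_mul_mellin hs]
    field_simp
    ring
  rw [hsub, norm_neg, norm_mul, div_eq_mul_one_div ‖s - 1‖]
  gcongr
  exact norm_mellin_fractIndicator_le hs

theorem zetaBlaschke_ne_zero_of_norm_sub_one_lt {s : ℂ} (hs : ‖s - 1‖ < s.re) :
    zetaBlaschke s ≠ 0 := by
  intro h
  have hre : 0 < s.re := (norm_nonneg _).trans_lt hs
  have := norm_zetaBlaschke_sub_one_le hre
  rw [h, zero_sub, norm_neg, norm_one, one_le_div hre] at this
  exact this.not_gt hs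

theorem analyticAt_riemannZeta {s : ℂ} (hs : s ≠ 1) : AnalyticAt ℂ riemannZeta s :=
  DifferentiableOn.analyticAt
    (fun _ hw ↦ (differentiableAt_riemannZeta hw).differentiableWithinAt)
    (isOpen_ne.mem_nhds hs)

theorem analyticOrderNatAt_zetaBlaschke {s : ℂ} (h0 : s ≠ 0) (h1 : s ≠ 1) :
    analyticOrderNatAt zetaBlaschke s = analyticOrderNatAt riemannZeta s := by
  have heq : zetaBlaschke =ᶠ[𝓝 s] (fun s ↦ (s - 1) / s) * riemannZeta := by
    filter_upwards [isOpen_ne.mem_nhds h1] with w hw using zetaBlaschke_eq hw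
  have hfactor : AnalyticAt ℂ (fun s : ℂ ↦ (s - 1) / s) s :=
    (analyticAt_id.sub analyticAt_const).div analyticAt_id h0
  rw [analyticOrderNatAt, analyticOrderNatAt, analyticOrderAt_congr heq,
    analyticOrderAt_mul hfactor (analyticAt_riemannZeta h1),
    hfactor.analyticOrderAt_eq_zero.2 (div_ne_zero (sub_ne_zero.2 h1) h0), zero_add]

theorem norm_riemannZeta_le {s : ℂ} (hs : 0 < s.re) (h1 : s ≠ 1) :
    ‖riemannZeta s‖ ≤ ‖s‖ * (1 / ‖s - 1‖ + 1 / s.re) := by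
  have h0 : s ≠ 0 := by rintro rfl; simp at hs
  have hs1 := sub_ne_zero.2 h1
  have hnorm : ‖s - 1‖ ≠ 0 := norm_ne_zero_iff.2 hs1
  have hzeta : riemannZeta s = s / (s - 1) * zetaBlaschke s := by
    rw [zetaBlaschke_eq h1]
    field_simp
  calc ‖riemannZeta s‖ = ‖s‖ / ‖s - 1‖ * ‖1 + (zetaBlaschke s - 1)‖ := by
        rw [hzeta, norm_mul, norm_div, add_sub_cancel]
    _ ≤ ‖s‖ / ‖s - 1‖ * (1 + ‖s - 1‖ / s.re) := by
        gcongr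
        exact (norm_add_le _ _).trans (by
          rw [norm_one]
          gcongr
          exact norm_zetaBlaschke_sub_one_le hs)
    _ = ‖s‖ * (1 / ‖s - 1‖ + 1 / s.re) := by field_simp

theorem norm_riemannZeta_sub_one_le {s : ℂ} (hs : 2 ≤ s.re) :
    ‖riemannZeta s - 1‖ ≤ (Real.pi ^ 2 / 6 - 1) * 2 ^ (2 - s.re) := by
  have h1 : 1 < s.re := by linarith
  have hasSum_sq : HasSum (fun n : ℕ ↦ 1 / ((n : ℝ) + 2) ^ 2) (Real.pi ^ 2 / 6 - 1) := by
    simpa [Finset.sum_range_succ] using (hasSum_nat_add_iff' 2).2 hasSum_zeta_two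
  have hsum : Summable (fun n : ℕ ↦ 1 / ((n : ℂ) + 1) ^ s) := by
    simpa using (summable_nat_add_iff 1).2 (Complex.summable_one_div_nat_cpow.2 h1)
  have tail_eq : riemannZeta s - 1 = ∑' n : ℕ, 1 / ((n : ℂ) + 2) ^ s := by
    rw [zeta_eq_tsum_one_div_nat_add_one_cpow h1, hsum.tsum_eq_zero_add]
    simp only [Nat.cast_zero, zero_add, Complex.one_cpow, div_one, add_sub_cancel_left,
      Nat.cast_add, Nat.cast_one, add_assoc, one_add_one_eq_two]
  have term_le (n : ℕ) : ‖1 / ((n : ℂ) + 2) ^ s‖ ≤ 1 / ((n : ℝ) + 2) ^ 2 * 2 ^ (2 - s.re) := by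
    have hn : (0 : ℝ) < (n : ℝ) + 2 := by positivity
    calc ‖1 / ((n : ℂ) + 2) ^ s‖ = ((n : ℝ) + 2) ^ (-2 + (2 - s.re)) := by
          rw [show (n : ℂ) + 2 = (((n : ℝ) + 2 : ℝ) : ℂ) by push_cast; rfl, norm_div, norm_one,
            Complex.norm_cpow_eq_rpow_re_of_pos hn, one_div, ← Real.rpow_neg hn.le]
          congr 1
          ring
      _ = 1 / ((n : ℝ) + 2) ^ 2 * ((n : ℝ) + 2) ^ (2 - s.re) := by
          rw [Real.rpow_add hn, Real.rpow_neg hn.le, Real.rpow_two, one_div]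
      _ ≤ 1 / ((n : ℝ) + 2) ^ 2 * 2 ^ (2 - s.re) := by
          exact mul_le_mul_of_nonneg_left (Real.rpow_le_rpow_of_nonpos two_pos
            (le_add_of_nonneg_left n.cast_nonneg) (by linarith)) (by positivity)
  rw [tail_eq]
  exact tsum_of_norm_bounded (hasSum_sq.mul_right _) term_le

theorem pow_three_le_mul_two_rpow {x : ℝ} (hx : 0 ≤ x) : x ^ 3 ≤ 24 * 2 ^ x := by
  have hlog := Real.log_two_gt_d9
  have hexp := Real.pow_div_factorial_le_exp (x * Real.log 2) (by positivity) 3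
  rw [mul_comm x, ← Real.rpow_def_of_pos two_pos, mul_pow] at hexp
  have hcube : (1 / 4 : ℝ) ≤ Real.log 2 ^ 3 := by
    calc (1 / 4 : ℝ) ≤ 0.68 ^ 3 := by norm_num
      _ ≤ Real.log 2 ^ 3 := by gcongr; linarith
  have := mul_le_mul_of_nonneg_right hcube (pow_nonneg hx 3)
  norm_num [Nat.factorial] at hexp
  linarith

theorem abs_log_norm_one_add_le {w : ℂ} (hw : ‖w‖ ≤ 2 / 3) : |Real.log ‖1 + w‖| ≤ 2 * ‖w‖ := by
  have hinv : (1 - ‖w‖)⁻¹ ≤ 3 := by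
    rw [inv_le_comm₀ (by linarith) (by norm_num)]
    linarith
  calc |Real.log ‖1 + w‖| ≤ ‖Complex.log (1 + w)‖ := by
        rw [← Complex.log_re]
        exact Complex.abs_re_le_norm _
    _ ≤ ‖w‖ ^ 2 * (1 - ‖w‖)⁻¹ / 2 + ‖w‖ := Complex.norm_log_one_add_le (by linarith)
    _ ≤ ‖w‖ ^ 2 * 3 / 2 + ‖w‖ := by gcongr
    _ ≤ 2 * ‖w‖ := by nlinarith [norm_nonneg w]

theorem abs_log_norm_riemannZeta_le {s : ℂ} (hs : 2 ≤ s.re) :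
    |Real.log ‖riemannZeta s‖| ≤ 128 / s.re ^ 3 := by
  have hpi : Real.pi ^ 2 / 6 - 1 ≤ 2 / 3 := by nlinarith [Real.pi_lt_d4, Real.pi_pos]
  have hzeta : ‖riemannZeta s - 1‖ ≤ 2 / 3 * 2 ^ (2 - s.re) :=
    (norm_riemannZeta_sub_one_le hs).trans (by gcongr)
  have hrpow : (2 : ℝ) ^ (2 - s.re) ≤ 1 :=
    Real.rpow_le_one_of_one_le_of_nonpos one_le_two (by linarith)
  calc |Real.log ‖riemannZeta s‖| ≤ 2 * ‖riemannZeta s - 1‖ := by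
        simpa using abs_log_norm_one_add_le (w := riemannZeta s - 1) (by linarith)
    _ ≤ 2 * (2 / 3 * 2 ^ (2 - s.re)) := by gcongr
    _ = 16 / 3 / 2 ^ s.re := by
        rw [Real.rpow_sub two_pos]
        norm_num
        ring
    _ ≤ 128 / s.re ^ 3 := by
        rw [div_le_div_iff₀ (by positivity) (by positivity)]
        linarith [pow_three_le_mul_two_rpow (x := s.re) (by linarith)]

end Zeta

section LogRatio

variable {z : ℂ}

theorem fderiv_log_norm_apply {f : ℂ → ℂ} {f' : ℂ} (hf : HasDerivAt f f' z) (hz : f z ≠ 0)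
    (v : ℂ) : fderiv ℝ (fun w ↦ Real.log ‖f w‖) z v = (f' / f z * v).re := by
  have hlog : HasDerivAt (fun w ↦ Complex.log (f w / f z)) (f' / f z) z := by
    simpa [div_self hz] using (hf.div_const (f z)).clog (by simp [div_self hz])
  have heq : (fun w ↦ Real.log ‖f w‖) =ᶠ[𝓝 z]
      fun w ↦ (Complex.log (f w / f z)).re + Real.log ‖f z‖ := by
    filter_upwards [hf.continuousAt.eventually_ne hz] with w hw
    rw [Complex.log_re, norm_div, Real.log_div (norm_ne_zero_iff.2 hw) (norm_ne_zero_iff.2 hz),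
      sub_add_cancel]
  rw [(((Complex.reCLM.hasFDerivAt.comp z (hlog.hasFDerivAt.restrictScalars ℝ)).add_const
    (Real.log ‖f z‖)).congr_of_eventuallyEq heq).fderiv]
  simp [mul_comm]

/-- The function `log |z / (1 - z)|`: harmonic away from `0` and `1`, it vanishes on the line
`re z = 1 / 2`, where its normal derivative is the weight of the truncated integral. -/
noncomputable def logRatio (z : ℂ) : ℝ := Real.log ‖z / (1 - z)‖

theorem logRatio_eq_sub (z : ℂ) : logRatio z = Real.log ‖z‖ - Real.log ‖z - 1‖ := by
  rw [logRatio, norm_div, norm_sub_rev 1]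
  rcases eq_or_ne z 0 with rfl | h0
  · simp
  rcases eq_or_ne z 1 with rfl | h1
  · simp
  exact Real.log_div (norm_ne_zero_iff.2 h0) (norm_ne_zero_iff.2 (sub_ne_zero.2 h1))

theorem harmonicAt_logRatio (h0 : z ≠ 0) (h1 : z ≠ 1) : HarmonicAt logRatio z :=
  (analyticAt_id.div (analyticAt_const.sub analyticAt_id)
    (sub_ne_zero.2 h1.symm)).harmonicAt_log_norm (div_ne_zero h0 (sub_ne_zero.2 h1.symm))

theorem fderiv_logRatio_apply (h0 : z ≠ 0) (h1 : z ≠ 1) (v : ℂ) :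
    fderiv ℝ logRatio z v = (v / (z * (1 - z))).re := by
  have hsub : 1 - z ≠ 0 := sub_ne_zero.2 h1.symm
  have hderiv : HasDerivAt (fun w : ℂ ↦ w / (1 - w)) (1 / (1 - z) ^ 2) z := by
    refine ((hasDerivAt_id z).div ((hasDerivAt_id z).const_sub 1) hsub).congr_deriv ?_
    simp
  refine (fderiv_log_norm_apply hderiv (div_ne_zero h0 hsub) v).trans ?_
  congr 1
  field_simp

theorem abs_fderiv_logRatio_le (h0 : z ≠ 0) (h1 : z ≠ 1) {v : ℂ} (hv : ‖v‖ = 1) :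
    |fderiv ℝ logRatio z v| ≤ 1 / (‖z‖ * ‖z - 1‖) := by
  rw [fderiv_logRatio_apply h0 h1]
  refine (Complex.abs_re_le_norm _).trans_eq ?_
  rw [norm_div, norm_mul, hv, norm_sub_rev]

theorem norm_half_add_sub_one (y : ℝ) : ‖(1 / 2 + y * I : ℂ) - 1‖ = ‖(1 / 2 + y * I : ℂ)‖ := by
  have hconj : (1 / 2 + y * I : ℂ) - 1 = -(starRingEnd ℂ) (1 / 2 + y * I) := by
    simp only [map_add, map_div₀, map_mul, map_one, map_ofNat, Complex.conj_ofReal, Complex.conj_I]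
    ring
  rw [hconj, norm_neg, Complex.norm_conj]

theorem logRatio_half_add (y : ℝ) : logRatio (1 / 2 + y * I) = 0 := by
  rw [logRatio_eq_sub, norm_half_add_sub_one, sub_self]

theorem half_add_ne_zero_and_ne_one (y : ℝ) :
    (1 / 2 + y * I : ℂ) ≠ 0 ∧ (1 / 2 + y * I : ℂ) ≠ 1 := by
  constructor <;> intro h <;> simpa using congrArg Complex.re h

theorem fderiv_logRatio_half_add (y : ℝ) :
    fderiv ℝ logRatio (1 / 2 + y * I) 1 = 1 / (1 / 4 + y ^ 2) := by
  obtain ⟨h0, h1⟩ := half_add_ne_zero_and_ne_one y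
  have hprod : (1 / 2 + y * I : ℂ) * (1 - (1 / 2 + y * I)) = ((1 / 4 + y ^ 2 : ℝ) : ℂ) := by
    push_cast
    linear_combination -(y : ℂ) ^ 2 * Complex.I_sq
  rw [fderiv_logRatio_apply h0 h1, hprod, ← Complex.ofReal_one, ← Complex.ofReal_div,
    Complex.ofReal_re]

theorem norm_sub_one_le_norm (hz : 1 / 2 ≤ z.re) : ‖z - 1‖ ≤ ‖z‖ := by
  rw [← sq_le_sq₀ (norm_nonneg _) (norm_nonneg _), Complex.sq_norm, Complex.sq_norm,
    Complex.normSq_apply, Complex.normSq_apply]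
  simp only [Complex.sub_re, Complex.sub_im, Complex.one_re, Complex.one_im]
  linarith

theorem logRatio_nonneg (hz : 1 / 2 ≤ z.re) : 0 ≤ logRatio z := by
  rcases eq_or_ne z 1 with rfl | h1
  · simp [logRatio]
  rw [logRatio_eq_sub, sub_nonneg]
  exact Real.log_le_log (norm_pos_iff.2 (sub_ne_zero.2 h1)) (norm_sub_one_le_norm hz)

theorem logRatio_le (hz : 1 / 2 ≤ z.re) (h1 : z ≠ 1) : logRatio z ≤ z.re / ‖z - 1‖ ^ 2 := by
  have h0 : z ≠ 0 := by rintro rfl; norm_num at hz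
  have hpos : 0 < ‖z - 1‖ := norm_pos_iff.2 (sub_ne_zero.2 h1)
  have hsq : ‖z‖ ^ 2 = ‖z - 1‖ ^ 2 + 2 * z.re - 1 := by
    simp only [Complex.sq_norm, Complex.normSq_apply, Complex.sub_re, Complex.sub_im,
      Complex.one_re, Complex.one_im]
    ring
  have hlog : 2 * logRatio z = Real.log (‖z‖ ^ 2 / ‖z - 1‖ ^ 2) := by
    rw [logRatio_eq_sub, Real.log_div (by positivity) (by positivity), Real.log_pow, Real.log_pow]
    push_cast
    ring
  have hle := Real.log_le_sub_one_of_pos (x := ‖z‖ ^ 2 / ‖z - 1‖ ^ 2) (by positivity)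
  rw [← hlog, hsq] at hle
  have : (‖z - 1‖ ^ 2 + 2 * z.re - 1) / ‖z - 1‖ ^ 2 - 1 ≤ 2 * (z.re / ‖z - 1‖ ^ 2) := by
    rw [sub_le_iff_le_add, div_le_iff₀ (by positivity), add_mul, mul_assoc,
      div_mul_cancel₀ _ (by positivity)]
    linarith
  linarith

theorem log_norm_riemannZeta_eq (h0 : z ≠ 0) (h1 : z ≠ 1) (hz : riemannZeta z ≠ 0) :
    Real.log ‖riemannZeta z‖ = Real.log ‖zetaBlaschke z‖ + logRatio z := by
  have hsub := sub_ne_zero.2 h1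
  rw [zetaBlaschke_eq h1, norm_mul, norm_div, logRatio_eq_sub, Real.log_mul (by positivity)
    (by positivity), Real.log_div (by positivity) (by positivity)]
  ring

end LogRatio

section Cutoff

variable {S y : ℝ} {z : ℂ}

/-- A smooth cut-off equal to `1` on `[-S, S]` and to `0` outside `[-(S + 1), S + 1]`. The
transitions being translates of a fixed one, its derivatives are bounded uniformly in `S`. -/
noncomputable def cutoff (S y : ℝ) : ℝ :=
  Real.smoothTransition (S + 1 - y) + Real.smoothTransition (S + 1 + y) - 1

theorem contDiff_cutoff (S : ℝ) {n : ℕ∞} : ContDiff ℝ n (cutoff S) :=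
  ((Real.smoothTransition.contDiff.comp (contDiff_const.sub contDiff_id)).add
    (Real.smoothTransition.contDiff.comp (contDiff_const.add contDiff_id))).sub contDiff_const

theorem cutoff_eq_one (hy : |y| ≤ S) : cutoff S y = 1 := by
  obtain ⟨h1, h2⟩ := abs_le.1 hy
  rw [cutoff, Real.smoothTransition.one_of_one_le (by linarith),
    Real.smoothTransition.one_of_one_le (by linarith), add_sub_cancel_right]

theorem cutoff_eq_zero (hS : 0 ≤ S) (hy : S + 1 ≤ |y|) : cutoff S y = 0 := by
  rcases le_abs.1 hy with h | h
  · rw [cutoff, Real.smoothTransition.zero_of_nonpos (by linarith),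
      Real.smoothTransition.one_of_one_le (by linarith), zero_add, sub_self]
  · rw [cutoff, Real.smoothTransition.one_of_one_le (by linarith),
      Real.smoothTransition.zero_of_nonpos (by linarith), add_zero, sub_self]

theorem cutoff_le_one (S y : ℝ) : cutoff S y ≤ 1 := by
  have h1 := Real.smoothTransition.le_one (S + 1 - y)
  have h2 := Real.smoothTransition.le_one (S + 1 + y)
  rw [cutoff]
  linarith

theorem cutoff_nonneg (hS : 0 ≤ S) (y : ℝ) : 0 ≤ cutoff S y := by
  have h1 := Real.smoothTransition.nonneg (S + 1 - y)
  have h2 := Real.smoothTransition.nonneg (S + 1 + y)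
  rw [cutoff]
  rcases le_total 0 y with h | h
  · rw [Real.smoothTransition.one_of_one_le (x := S + 1 + y) (by linarith)]
    linarith
  · rw [Real.smoothTransition.one_of_one_le (x := S + 1 - y) (by linarith)]
    linarith

theorem abs_cutoff_le_one (hS : 0 ≤ S) (y : ℝ) : |cutoff S y| ≤ 1 := by
  rw [abs_of_nonneg (cutoff_nonneg hS y)]
  exact cutoff_le_one S y

theorem cutoff_eventuallyEq_one (hy : |y| < S) : cutoff S =ᶠ[𝓝 y] fun _ ↦ 1 := by
  filter_upwards [continuous_abs.continuousAt.eventually_lt_const hy] with x hx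
  exact cutoff_eq_one (le_of_lt hx)

theorem hasCompactSupport_deriv_smoothTransition :
    HasCompactSupport (deriv Real.smoothTransition) := by
  refine HasCompactSupport.intro (isCompact_Icc (a := (0 : ℝ)) (b := 1)) fun x hx ↦ ?_
  rcases lt_or_ge x 0 with h | h
  · have : Real.smoothTransition =ᶠ[𝓝 x] fun _ ↦ 0 := by
      filter_upwards [Iio_mem_nhds h] with w hw
      exact Real.smoothTransition.zero_of_nonpos (le_of_lt hw)
    rw [this.deriv_eq, deriv_const]
  · have : Real.smoothTransition =ᶠ[𝓝 x] fun _ ↦ 1 := by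
      filter_upwards [Ioi_mem_nhds (not_le.1 fun h' ↦ hx ⟨h, h'⟩)] with w hw
      exact Real.smoothTransition.one_of_one_le (le_of_lt hw)
    rw [this.deriv_eq, deriv_const]

theorem deriv_comp_sub_add_comp_add {f : ℝ → ℝ} (hf : Differentiable ℝ f) (ε a c y : ℝ) :
    deriv (fun y ↦ ε * f (a - y) + f (a + y) - c) y =
      -ε * deriv f (a - y) + deriv f (a + y) := by
  have h1 : HasDerivAt (fun y ↦ f (a - y)) (-deriv f (a - y)) y :=
    (hf _).hasDerivAt.comp_const_sub a y
  have h2 : HasDerivAt (fun y ↦ f (a + y)) (deriv f (a + y)) y :=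
    (hf _).hasDerivAt.comp_const_add a y
  rw [(((h1.const_mul ε).fun_add h2).sub_const c).deriv]
  ring

theorem exists_abs_deriv_cutoff_le : ∃ C, 0 ≤ C ∧ ∀ S y : ℝ,
    |deriv (cutoff S) y| ≤ C ∧ |deriv (deriv (cutoff S)) y| ≤ C := by
  have hs : ContDiff ℝ 2 Real.smoothTransition := Real.smoothTransition.contDiff
  have hs' : ContDiff ℝ 1 (deriv Real.smoothTransition) :=
    ((contDiff_succ_iff_deriv (n := 1)).1 hs).2.2
  obtain ⟨C₁, hC₁⟩ := hs'.continuous.bounded_above_of_compact_support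
    hasCompactSupport_deriv_smoothTransition
  obtain ⟨C₂, hC₂⟩ := (hs'.continuous_deriv le_rfl).bounded_above_of_compact_support
    hasCompactSupport_deriv_smoothTransition.deriv
  have hC₁0 := (norm_nonneg _).trans (hC₁ 0)
  have hC₂0 := (norm_nonneg _).trans (hC₂ 0)
  have first (S : ℝ) : deriv (cutoff S) = fun y ↦
      -1 * deriv Real.smoothTransition (S + 1 - y) +
        deriv Real.smoothTransition (S + 1 + y) - 0 := by
    funext y
    rw [sub_zero, ← deriv_comp_sub_add_comp_add (hs.differentiable two_ne_zero) 1 (S + 1) 1]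
    simp only [one_mul]
    rfl
  refine ⟨2 * C₁ + 2 * C₂, by positivity, fun S y ↦ ⟨?_, ?_⟩⟩
  · have h1 := abs_le.1 (hC₁ (S + 1 - y))
    have h2 := abs_le.1 (hC₁ (S + 1 + y))
    rw [first, abs_le]
    constructor <;> linarith
  · have h1 := abs_le.1 (hC₂ (S + 1 - y))
    have h2 := abs_le.1 (hC₂ (S + 1 + y))
    rw [first, deriv_comp_sub_add_comp_add (hs'.differentiable one_ne_zero), abs_le]
    constructor <;> linarith

theorem fderiv_re_mul_im_apply {f g : ℝ → ℝ} (hf : DifferentiableAt ℝ f z.re)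
    (hg : DifferentiableAt ℝ g z.im) (v : ℂ) :
    fderiv ℝ (fun z : ℂ ↦ f z.re * g z.im) z v =
      deriv f z.re * g z.im * v.re + f z.re * deriv g z.im * v.im := by
  have h1 : HasFDerivAt (fun z : ℂ ↦ f z.re) (deriv f z.re • Complex.reCLM) z :=
    hf.hasDerivAt.comp_hasFDerivAt z Complex.reCLM.hasFDerivAt
  have h2 : HasFDerivAt (fun z : ℂ ↦ g z.im) (deriv g z.im • Complex.imCLM) z :=
    hg.hasDerivAt.comp_hasFDerivAt z Complex.imCLM.hasFDerivAt
  rw [(h1.fun_mul h2).fderiv]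
  simp only [add_apply, smul_apply, smul_eq_mul, Complex.reCLM_apply, Complex.imCLM_apply]
  ring

theorem laplacian_re_mul_im {f g : ℝ → ℝ} (hf : ContDiff ℝ 2 f) (hg : ContDiff ℝ 2 g) (z : ℂ) :
    Δ (fun z : ℂ ↦ f z.re * g z.im) z =
      deriv (deriv f) z.re * g z.im + f z.re * deriv (deriv g) z.im := by
  have hf1 := hf.differentiable two_ne_zero
  have hg1 := hg.differentiable two_ne_zero
  have hf2 : Differentiable ℝ (deriv f) := (hf.differentiable_deriv_two)
  have hg2 : Differentiable ℝ (deriv g) := (hg.differentiable_deriv_two)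
  have hcont : ContDiff ℝ 2 fun z : ℂ ↦ f z.re * g z.im :=
    (hf.comp Complex.reCLM.contDiff).mul (hg.comp Complex.imCLM.contDiff)
  rw [laplacian_eq_fderiv_fderiv hcont.contDiffAt]
  simp_rw [fderiv_re_mul_im_apply (hf1 _) (hg1 _), Complex.one_re, Complex.one_im, Complex.I_re,
    Complex.I_im, mul_one, mul_zero, add_zero, zero_add]
  rw [fderiv_re_mul_im_apply (hf2 _) (hg1 _), fderiv_re_mul_im_apply (hf1 _) (hg2 _)]
  simp

/-- The smooth cut-off of the plane to the square of side `2S` centred at `0`. -/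
noncomputable def boxCutoff (S : ℝ) (z : ℂ) : ℝ := cutoff S z.re * cutoff S z.im

theorem contDiff_boxCutoff (S : ℝ) : ContDiff ℝ 2 (boxCutoff S) :=
  ((contDiff_cutoff S).comp Complex.reCLM.contDiff).mul
    ((contDiff_cutoff S).comp Complex.imCLM.contDiff)

theorem tsupport_boxCutoff_subset (hS : 0 ≤ S) :
    tsupport (boxCutoff S) ⊆ Icc (-(S + 1)) (S + 1) ×ℂ Icc (-(S + 1)) (S + 1) := by
  have mem {y : ℝ} (h : cutoff S y ≠ 0) : y ∈ Icc (-(S + 1)) (S + 1) :=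
    abs_le.1 (not_lt.1 fun h' ↦ h (cutoff_eq_zero hS h'.le))
  exact closure_minimal (fun z hz ↦ ⟨mem (left_ne_zero_of_mul hz), mem (right_ne_zero_of_mul hz)⟩)
    (isClosed_Icc.reProdIm isClosed_Icc)

theorem hasCompactSupport_boxCutoff (hS : 0 ≤ S) : HasCompactSupport (boxCutoff S) :=
  (isCompact_Icc.reProdIm isCompact_Icc).of_isClosed_subset (isClosed_tsupport _)
    (tsupport_boxCutoff_subset hS)

theorem boxCutoff_eventuallyEq_one (hre : |z.re| < S) (him : |z.im| < S) :
    boxCutoff S =ᶠ[𝓝 z] fun _ ↦ 1 := by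
  filter_upwards [Complex.continuous_re.continuousAt.eventually (cutoff_eventuallyEq_one hre),
    Complex.continuous_im.continuousAt.eventually (cutoff_eventuallyEq_one him)] with w h1 h2
  rw [boxCutoff, h1, h2, one_mul]

theorem exists_abs_fderiv_boxCutoff_le : ∃ C, 0 ≤ C ∧ ∀ S, 0 ≤ S → ∀ z,
    |fderiv ℝ (boxCutoff S) z 1| ≤ C ∧ |fderiv ℝ (boxCutoff S) z I| ≤ C ∧
      |Δ (boxCutoff S) z| ≤ 2 * C := by
  obtain ⟨C, hC0, hC⟩ := exists_abs_deriv_cutoff_le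
  have mul_le {a b : ℝ} (ha : |a| ≤ C) (hb : |b| ≤ 1) : |a * b| ≤ C := by
    rw [abs_mul]
    exact (mul_le_of_le_one_right (abs_nonneg a) hb).trans ha
  refine ⟨C, hC0, fun S hS z ↦ ?_⟩
  have hd : Differentiable ℝ (cutoff S) := (contDiff_cutoff S (n := 1)).differentiable one_ne_zero
  have hle := abs_cutoff_le_one hS
  unfold boxCutoff
  refine ⟨?_, ?_, ?_⟩
  · rw [fderiv_re_mul_im_apply (hd _) (hd _)]
    simpa using mul_le (hC S z.re).1 (hle z.im)
  · rw [fderiv_re_mul_im_apply (hd _) (hd _), mul_comm (cutoff S z.re)]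
    simpa using mul_le (hC S z.im).1 (hle z.re)
  · rw [laplacian_re_mul_im (contDiff_cutoff S) (contDiff_cutoff S), two_mul,
      mul_comm (cutoff S z.re)]
    exact (abs_add_le _ _).trans
      (add_le_add (mul_le (hC S z.re).2 (hle z.im)) (mul_le (hC S z.im).2 (hle z.re)))

end Cutoff

section Commutator

variable {χ g h : ℂ → ℝ} {z : ℂ}

/-- The commutator `Δ(χ g) - χ Δ g` of the Laplacian with the multiplication by `χ`. -/
noncomputable def laplacianCommutator (χ g : ℂ → ℝ) (z : ℂ) : ℝ :=
  g z * Δ χ z + 2 * (fderiv ℝ χ z 1 * fderiv ℝ g z 1 + fderiv ℝ χ z I * fderiv ℝ g z I)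

theorem laplacian_mul_eq_add_commutator (hχ : ContDiff ℝ 2 χ) (hg : ContDiff ℝ 2 g) (z : ℂ) :
    Δ (fun w ↦ χ w * g w) z = χ z * Δ g z + laplacianCommutator χ g z := by
  rw [laplacian_mul hχ hg, laplacianCommutator, add_assoc]

theorem abs_laplacianCommutator_le (χ g : ℂ → ℝ) (z : ℂ) : |laplacianCommutator χ g z| ≤
    |g z| * |Δ χ z| +
      2 * (|fderiv ℝ χ z 1| * |fderiv ℝ g z 1| + |fderiv ℝ χ z I| * |fderiv ℝ g z I|) := by
  rw [laplacianCommutator, ← abs_mul, ← abs_mul, ← abs_mul]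
  refine (abs_add_le _ _).trans (add_le_add_right ?_ _)
  rw [abs_mul, abs_two]
  gcongr
  exact abs_add_le _ _

theorem laplacianCommutator_congr (hgh : g =ᶠ[𝓝 z] h) :
    laplacianCommutator χ g z = laplacianCommutator χ h z := by
  rw [laplacianCommutator, laplacianCommutator, hgh.eq_of_nhds, hgh.fderiv_eq]

theorem laplacianCommutator_eq_zero {c : ℝ} (hχ : χ =ᶠ[𝓝 z] fun _ ↦ c) :
    laplacianCommutator χ g z = 0 := by
  rw [laplacianCommutator, hχ.fderiv_eq, (laplacian_congr_nhds hχ).eq_of_nhds]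
  simp

/-- The closed square frame outside of which the cut-off `boxCutoff S` is locally constant. -/
def frame (S : ℝ) : Set ℂ :=
  {z | |z.re| ≤ S + 1 ∧ |z.im| ≤ S + 1 ∧ (S ≤ |z.re| ∨ S ≤ |z.im|)}

theorem laplacianCommutator_boxCutoff_eq_zero {S : ℝ} (hS : 0 ≤ S) (hz : z ∉ frame S) :
    laplacianCommutator (boxCutoff S) g z = 0 := by
  by_cases hsupp : z ∈ tsupport (boxCutoff S)
  · obtain ⟨hre, him⟩ := tsupport_boxCutoff_subset hS hsupp
    have : ¬(S ≤ |z.re| ∨ S ≤ |z.im|) := fun h ↦ hz ⟨abs_le.2 hre, abs_le.2 him, h⟩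
    rw [not_or, not_le, not_le] at this
    exact laplacianCommutator_eq_zero (boxCutoff_eventuallyEq_one this.1 this.2)
  · exact laplacianCommutator_eq_zero (notMem_tsupport_iff_eventuallyEq.1 hsupp)

theorem exists_abs_laplacianCommutator_boxCutoff_le : ∃ C, 0 ≤ C ∧ ∀ S, 2 ≤ S → ∀ z ∈ frame S,
    1 / 2 ≤ z.re → |laplacianCommutator (boxCutoff S) logRatio z| ≤ C / S ^ 2 * z.re := by
  obtain ⟨C, hC0, hC⟩ := exists_abs_fderiv_boxCutoff_le
  refine ⟨24 * C, by positivity, fun S hS z hz hre ↦ ?_⟩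
  obtain ⟨hC1, hCI, hCΔ⟩ := hC S (by linarith) z
  have norm_ge : S ≤ ‖z‖ :=
    hz.2.2.elim (·.trans (Complex.abs_re_le_norm z)) (·.trans (Complex.abs_im_le_norm z))
  have norm_sub_ge : S / 2 ≤ ‖z - 1‖ := by
    have := norm_sub_norm_le z 1
    rw [norm_one] at this
    linarith
  have h0 : z ≠ 0 := by rintro rfl; norm_num at hre
  have h1 : z ≠ 1 := by rintro rfl; norm_num at norm_sub_ge; linarith
  have logRatio_bound : |logRatio z| ≤ 4 / S ^ 2 * z.re := by
    calc |logRatio z| = logRatio z := abs_of_nonneg (logRatio_nonneg hre)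
      _ ≤ z.re / ‖z - 1‖ ^ 2 := logRatio_le hre h1
      _ ≤ z.re / (S / 2) ^ 2 := by gcongr
      _ = 4 / S ^ 2 * z.re := by field_simp; norm_num
  have fderiv_bound {v : ℂ} (hv : ‖v‖ = 1) : |fderiv ℝ logRatio z v| ≤ 4 / S ^ 2 * z.re := by
    calc |fderiv ℝ logRatio z v| ≤ 1 / (‖z‖ * ‖z - 1‖) := abs_fderiv_logRatio_le h0 h1 hv
      _ ≤ 1 / (S * (S / 2)) := by gcongr
      _ = 4 / S ^ 2 * (1 / 2) := by field_simp; norm_num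
      _ ≤ 4 / S ^ 2 * z.re := by gcongr
  calc |laplacianCommutator (boxCutoff S) logRatio z|
      ≤ |logRatio z| * |Δ (boxCutoff S) z| +
          2 * (|fderiv ℝ (boxCutoff S) z 1| * |fderiv ℝ logRatio z 1| +
            |fderiv ℝ (boxCutoff S) z I| * |fderiv ℝ logRatio z I|) :=
        abs_laplacianCommutator_le _ _ _
    _ ≤ 4 / S ^ 2 * z.re * (2 * C) +
          2 * (C * (4 / S ^ 2 * z.re) + C * (4 / S ^ 2 * z.re)) := by
        gcongr
        · exact fderiv_bound norm_one
        · exact fderiv_bound Complex.norm_I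
    _ = 24 * C / S ^ 2 * z.re := by ring

end Commutator

section Pole

variable {c : ℂ} {a r R k : ℝ} {h v g : ℂ → ℝ}

theorem lt_re_of_mem_closedBall {z : ℂ} (ha : a + R < c.re) (hz : z ∈ closedBall c R) :
    a < z.re := by
  have := (abs_le.1 ((Complex.abs_re_le_norm (z - c)).trans (mem_closedBall_iff_norm.1 hz))).1
  rw [Complex.sub_re] at this
  linarith

theorem IsTestFunction.bump_mul (b : ContDiffBump c) (ha : a + b.rOut < c.re)
    (hh : HarmonicOnNhd h (closedBall c b.rOut)) : IsTestFunction a fun z ↦ b z * h z where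
  contDiff := contDiff_iff_contDiffAt.2 fun z ↦ by
    by_cases hz : z ∈ tsupport b
    · exact b.contDiff.contDiffAt.mul (hh z (b.tsupport_eq ▸ hz)).1
    · refine (contDiffAt_const (c := (0 : ℝ))).congr_of_eventuallyEq ?_
      filter_upwards [notMem_tsupport_iff_eventuallyEq.1 hz] with w hw
      rw [hw, Pi.zero_apply, zero_mul]
  hasCompactSupport := b.hasCompactSupport.mul_right
  eq_zero y := by
    have : (a + y * I : ℂ) ∉ ball c b.rOut := fun h ↦ by
      simpa using lt_re_of_mem_closedBall ha (ball_subset_closedBall h)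
    rw [b.zero_of_le_dist (not_lt.1 this), zero_mul]

theorem setIntegral_halfPlane_bump_mul (b : ContDiffBump c) (ha : a + b.rOut < c.re)
    (hv : ∀ z ∈ closedBall c b.rOut \ ball c b.rIn, v z = 0) :
    ∫ z in {z : ℂ | a < z.re}, b z * h z * v z = ∫ z in ball c b.rIn, h z * v z := by
  have ball_subset : ball c b.rIn ⊆ {z | a < z.re} := fun z hz ↦
    lt_re_of_mem_closedBall ha
      (closedBall_subset_closedBall b.rIn_lt_rOut.le (ball_subset_closedBall hz))
  rw [setIntegral_eq_of_subset_of_forall_sdiff_eq_zero (measurableSet_halfPlane a) ball_subset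
    fun z hz ↦ ?_]
  · exact setIntegral_congr_fun measurableSet_ball fun z hz ↦ by
      simp only [b.one_of_mem_closedBall (ball_subset_closedBall hz), one_mul]
  · by_cases hball : z ∈ closedBall c b.rOut
    · rw [hv z ⟨hball, hz.2⟩, mul_zero]
    · rw [b.zero_of_le_dist (not_le.1 hball).le, zero_mul, zero_mul]

theorem bump_mul_eventuallyEq (b : ContDiffBump c) {z : ℂ} (hz : z ∈ ball c b.rIn) :
    (fun z ↦ b z * h z) =ᶠ[𝓝 z] h := by
  filter_upwards [b.eventuallyEq_one_of_mem_ball hz] with w hw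
  rw [hw, Pi.one_apply, one_mul]

theorem harmonicAt_add_mul_log_norm_sub {z : ℂ} (hv : HarmonicAt v z) (hz : z ≠ c) (k : ℝ) :
    HarmonicAt (fun z ↦ v z + k * Real.log ‖z - c‖) z :=
  hv.add (((analyticAt_id.sub analyticAt_const).harmonicAt_log_norm
    (sub_ne_zero.2 hz)).const_smul (c := k))

theorem setIntegral_ball_mul_laplacian (hr : 0 < r) (hrR : r < R)
    (hh : HarmonicOnNhd h (closedBall c R)) (hv : HarmonicOnNhd v (closedBall c R))
    (hg : ContDiff ℝ 2 g)
    (hgv : ∀ z ∈ closedBall c R \ ball c r, g =ᶠ[𝓝 z] fun z ↦ v z + k * Real.log ‖z - c‖) :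
    ∫ z in ball c r, h z * Δ g z = k * (2 * Real.pi * h c) := by
  obtain ⟨a, ha⟩ : ∃ a, a + R < c.re := ⟨c.re - R - 1, by linarith⟩
  set b : ContDiffBump c := ⟨r, R, hr, hrR⟩
  set ψ : ℂ → ℝ := fun z ↦ b z * h z
  have hψ : IsTestFunction a ψ := .bump_mul b ha hh
  have tsupport_subset : tsupport ψ ⊆ closedBall c R :=
    tsupport_mul_subset_left.trans_eq b.tsupport_eq
  have mem_ball : c ∈ ball c r := mem_ball_self hr
  have ψ_apply : ψ c = h c := (bump_mul_eventuallyEq b mem_ball).eq_of_nhds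
  have ball_subset : ball c r ⊆ closedBall c R := ball_subset_closedBall.trans
    (closedBall_subset_closedBall hrR.le)
  have laplacian_eq_zero : ∀ z ∈ closedBall c R \ ball c r, Δ g z = 0 := fun z hz ↦ by
    have hzc : z ≠ c := fun h ↦ hz.2 (h ▸ mem_ball)
    rw [(laplacian_congr_nhds (hgv z hz)).eq_of_nhds,
      (harmonicAt_add_mul_log_norm_sub (hv z hz.1) hzc k).2.eq_of_nhds, Pi.zero_apply]
  have green_g : GreenIdentity a ψ (fun z ↦ v z + k * Real.log ‖z - c‖)
      (∫ z in {z | a < z.re}, ψ z * Δ g z) := by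
    refine (GreenIdentity.of_contDiff hψ hg).congr_ae (.of_forall fun y hy ↦ ?_)
      (.of_forall fun z _ hz ↦ ?_)
    · have : (a + y * I : ℂ) ∈ tsupport ψ :=
        support_fderiv_subset ℝ fun h ↦ hy (by rw [h]; rfl)
      simpa using lt_re_of_mem_closedBall ha (tsupport_subset this)
    · refine (hgv z ⟨tsupport_subset (not_imp_comm.1 laplacian_eq_zero_of_notMem_tsupport hz),
        fun hball ↦ hz ?_⟩).eq_of_nhds
      rw [(laplacian_congr_nhds (bump_mul_eventuallyEq b hball)).eq_of_nhds,
        (hh z (ball_subset hball)).2.eq_of_nhds, Pi.zero_apply]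
  have green_pole : GreenIdentity a ψ (fun z ↦ v z + k * Real.log ‖z - c‖)
      (0 + k * (2 * Real.pi * {z : ℂ | a < z.re}.indicator ψ c)) :=
    (GreenIdentity.of_harmonicOnNhd hψ (hv.mono (inter_subset_left.trans tsupport_subset))).add
      ((GreenIdentity.log_norm_sub hψ c).const_mul k)
  have mem_halfPlane : c ∈ {z : ℂ | a < z.re} := lt_re_of_mem_closedBall ha (ball_subset mem_ball)
  rw [← setIntegral_halfPlane_bump_mul b ha laplacian_eq_zero, ← green_g.integral_add_setIntegral,
    green_pole.integral_add_setIntegral, indicator_of_mem mem_halfPlane, ψ_apply, zero_add]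

end Pole

section Identity

theorem half_add_notMem_ball (y : ℝ) : (1 / 2 + y * I : ℂ) ∉ ball 1 (1 / 4) := fun h ↦ by
  have := (Complex.abs_re_le_norm _).trans_lt (mem_ball_iff_norm.1 h)
  norm_num at this

theorem boxCutoff_half_add {S : ℝ} (hS : 1 / 2 ≤ S) (y : ℝ) :
    boxCutoff S (1 / 2 + y * I) = cutoff S y := by
  simp [boxCutoff, cutoff_eq_one (y := (2 : ℝ)⁻¹) (S := S) (by rw [abs_of_pos] <;> linarith)]

theorem zetaBlaschke_ne_zero_of_mem_closedBall {z : ℂ} (hz : z ∈ closedBall 1 (1 / 3)) :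
    zetaBlaschke z ≠ 0 := by
  rw [mem_closedBall_iff_norm] at hz
  have := (abs_le.1 ((Complex.abs_re_le_norm (z - 1)).trans hz)).1
  rw [Complex.sub_re, Complex.one_re] at this
  exact zetaBlaschke_ne_zero_of_norm_sub_one_lt (by linarith)

theorem ne_zero_of_re_pos {z : ℂ} (hz : 0 < z.re) : z ≠ 0 := by
  rintro rfl
  simp at hz

theorem harmonicOnNhd_log_norm_zetaBlaschke :
    HarmonicOnNhd (fun z ↦ Real.log ‖zetaBlaschke z‖) (closedBall 1 (1 / 3)) := fun z hz ↦
  (analyticAt_zetaBlaschke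
    (ne_zero_of_re_pos (lt_re_of_mem_closedBall (by norm_num) hz))).harmonicAt_log_norm
    (zetaBlaschke_ne_zero_of_mem_closedBall hz)

theorem countable_riemannZetaZeros : riemannZetaZeros.Countable :=
  (HereditarilyLindelofSpace.isLindelof _).countable_of_isDiscrete isDiscrete_riemannZetaZeros

/-- The sum `zeroSum (S + 1)` with the zero `β + iγ` weighted by `cutoff S γ`. -/
noncomputable def smoothedZeroSum (S : ℝ) : ℝ :=
  ∑ ρ ∈ (zerosRightOfLine_finite (S + 1)).toFinset,
    analyticOrderNatAt riemannZeta ρ * (cutoff S ρ.im * logRatio ρ)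

/-- A smooth function which agrees with `logRatio` on the right of the critical line, near the
support of `boxCutoff S` but away from the pole at `1`. -/
structure IsSmoothing (S : ℝ) (g : ℂ → ℝ) : Prop where
  contDiff : ContDiff ℝ 2 g
  eventuallyEq : ∀ z ∈ tsupport (boxCutoff S), 1 / 2 ≤ z.re → z ∉ ball 1 (1 / 4) →
    g =ᶠ[𝓝 z] logRatio

variable {S : ℝ} {g : ℂ → ℝ} {z : ℂ}

theorem analyticOrderAt_zetaBlaschke_ne_top (hz : 0 < z.re) :
    analyticOrderAt zetaBlaschke z ≠ ⊤ :=
  AnalyticOnNhd.analyticOrderAt_ne_top_of_isPreconnected (U := {z : ℂ | 0 < z.re}) (x := 1)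
    (fun _ hz ↦ analyticAt_zetaBlaschke (ne_zero_of_re_pos hz))
    (convex_halfSpace_re_gt 0).isPreconnected (by simp) hz (by
      rw [(analyticAt_zetaBlaschke one_ne_zero).analyticOrderAt_eq_zero.2
        (by simp [zetaBlaschke_one])]
      exact ENat.zero_ne_top)

theorem mem_zerosRightOfLine {ρ : ℂ} {T : ℝ} (hre : 1 / 2 < ρ.re) (him : ρ.im ∈ Icc (-T) T)
    (hρ : zetaBlaschke ρ = 0) : ρ ∈ zerosRightOfLine T := by
  have h1 : ρ ≠ 1 := by
    rintro rfl
    exact one_ne_zero (zetaBlaschke_one.symm.trans hρ)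
  have h0 : 0 < ρ.re := one_half_pos.trans hre
  rw [zetaBlaschke_eq h1] at hρ
  have hζ : riemannZeta ρ = 0 :=
    (mul_eq_zero.1 hρ).resolve_left (div_ne_zero (sub_ne_zero.2 h1) (ne_zero_of_re_pos h0))
  exact ⟨⟨hζ, h0, not_le.1 fun h ↦ riemannZeta_ne_zero_of_one_le_re h hζ⟩, him, hre⟩

theorem exists_isSmoothing (hS : 0 ≤ S) : ∃ g, IsSmoothing S g := by
  have hK : IsCompact ((tsupport (boxCutoff S) ∩ {z | 1 / 2 ≤ z.re}) \ ball 1 (1 / 4)) :=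
    ((hasCompactSupport_boxCutoff hS).isCompact.inter_right
      (isClosed_le continuous_const Complex.continuous_re)).diff isOpen_ball
  obtain ⟨g, hg, hgG⟩ := exists_contDiff_eventuallyEq (n := 2) hK fun z hz ↦
    (harmonicAt_logRatio (ne_zero_of_re_pos (one_half_pos.trans_le hz.1.2))
      fun h ↦ hz.2 (h ▸ mem_ball_self (by norm_num))).1
  exact ⟨g, hg, fun z hz hre hball ↦ hgG z ⟨⟨hz, hre⟩, hball⟩⟩

theorem boxCutoff_eventuallyEq_one_of_mem_closedBall (hS : 2 ≤ S) (hz : z ∈ closedBall 1 (1 / 3)) :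
    boxCutoff S =ᶠ[𝓝 z] fun _ ↦ 1 := by
  have norm_lt : ‖z‖ < S := by
    have := norm_le_norm_add_norm_sub' z 1
    rw [norm_one] at this
    linarith [mem_closedBall_iff_norm.1 hz]
  exact boxCutoff_eventuallyEq_one ((Complex.abs_re_le_norm z).trans_lt norm_lt)
    ((Complex.abs_im_le_norm z).trans_lt norm_lt)

theorem ball_one_subset_closedBall : ball (1 : ℂ) (1 / 4) ⊆ closedBall 1 (1 / 3) :=
  ball_subset_closedBall.trans (closedBall_subset_closedBall (by norm_num))

theorem ball_one_subset_halfPlane : ball (1 : ℂ) (1 / 4) ⊆ {z : ℂ | 1 / 2 < z.re} := fun _ hz ↦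
  lt_re_of_mem_closedBall (by norm_num) (ball_one_subset_closedBall hz)

namespace IsSmoothing

variable (hg : IsSmoothing S g)
include hg

theorem boxCutoff_mul_eventuallyEq (hre : 1 / 2 ≤ z.re) (hz : z ∉ ball 1 (1 / 4)) :
    (fun w ↦ boxCutoff S w * g w) =ᶠ[𝓝 z] fun w ↦ boxCutoff S w * logRatio w := by
  by_cases hsupp : z ∈ tsupport (boxCutoff S)
  · filter_upwards [hg.eventuallyEq z hsupp hre hz] with w hw
    rw [hw]
  · filter_upwards [notMem_tsupport_iff_eventuallyEq.1 hsupp] with w hw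
    rw [hw, Pi.zero_apply, zero_mul, zero_mul]

theorem isTestFunction (hS : 0 ≤ S) : IsTestFunction (1 / 2) fun z ↦ boxCutoff S z * g z where
  contDiff := (contDiff_boxCutoff S).mul hg.contDiff
  hasCompactSupport := (hasCompactSupport_boxCutoff hS).mul_right
  eq_zero y := by
    push_cast
    rw [(hg.boxCutoff_mul_eventuallyEq (by simp) (half_add_notMem_ball y)).eq_of_nhds,
      logRatio_half_add, mul_zero]

theorem fderiv_boxCutoff_mul (hS : 2 ≤ S) (y : ℝ) :
    fderiv ℝ (fun z ↦ boxCutoff S z * g z) (1 / 2 + y * I) 1 = cutoff S y / (1 / 4 + y ^ 2) := by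
  obtain ⟨h0, h1⟩ := half_add_ne_zero_and_ne_one y
  have hχ := ((contDiff_boxCutoff S).differentiable two_ne_zero (1 / 2 + y * I)).hasFDerivAt
  have hG := ((harmonicAt_logRatio h0 h1).1.differentiableAt two_ne_zero).hasFDerivAt
  rw [(hg.boxCutoff_mul_eventuallyEq (by simp) (half_add_notMem_ball y)).fderiv_eq,
    (hχ.fun_mul hG).fderiv]
  simp only [add_apply, smul_apply, smul_eq_mul, logRatio_half_add, fderiv_logRatio_half_add,
    boxCutoff_half_add (show 1 / 2 ≤ S by linarith)]
  ring

theorem laplacian_eq_zero (hre : 1 / 2 ≤ z.re) (hz : z ∉ ball 1 (1 / 4))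
    (hsupp : z ∈ tsupport (boxCutoff S)) : Δ g z = 0 := by
  have h1 : z ≠ 1 := fun h ↦ hz (h ▸ mem_ball_self (by norm_num))
  rw [(laplacian_congr_nhds (hg.eventuallyEq z hsupp hre hz)).eq_of_nhds,
    (harmonicAt_logRatio (ne_zero_of_re_pos (one_half_pos.trans_le hre)) h1).2.eq_of_nhds,
    Pi.zero_apply]

theorem laplacian_boxCutoff_mul_of_notMem_ball (hre : 1 / 2 ≤ z.re) (hz : z ∉ ball 1 (1 / 4)) :
    Δ (fun z ↦ boxCutoff S z * g z) z = laplacianCommutator (boxCutoff S) logRatio z := by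
  rw [laplacian_mul_eq_add_commutator (contDiff_boxCutoff S) hg.contDiff]
  by_cases hsupp : z ∈ tsupport (boxCutoff S)
  · rw [hg.laplacian_eq_zero hre hz hsupp, mul_zero, zero_add,
      laplacianCommutator_congr (hg.eventuallyEq z hsupp hre hz)]
  · have hχ := notMem_tsupport_iff_eventuallyEq.1 hsupp
    rw [hχ.eq_of_nhds, Pi.zero_apply, zero_mul, zero_add, laplacianCommutator_eq_zero hχ,
      laplacianCommutator_eq_zero hχ]

theorem setIntegral_boxCutoff_mul (hS : 2 ≤ S) :
    ∫ z in {z : ℂ | 1 / 2 < z.re}, boxCutoff S z * g z * Δ g z =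
      ∫ z in ball 1 (1 / 4), g z * Δ g z := by
  rw [setIntegral_eq_of_subset_of_forall_sdiff_eq_zero (measurableSet_halfPlane _)
    ball_one_subset_halfPlane fun z hz ↦ ?_]
  · exact setIntegral_congr_fun measurableSet_ball fun z hz ↦ by
      simp only [(boxCutoff_eventuallyEq_one_of_mem_closedBall hS
        (ball_one_subset_closedBall hz)).eq_of_nhds, one_mul]
  · by_cases hsupp : z ∈ tsupport (boxCutoff S)
    · rw [hg.laplacian_eq_zero (le_of_lt hz.1) hz.2 hsupp, mul_zero]
    · rw [image_eq_zero_of_notMem_tsupport hsupp, zero_mul, zero_mul]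

theorem setIntegral_log_norm_zetaBlaschke_mul (hS : 2 ≤ S) :
    ∫ z in ball 1 (1 / 4), Real.log ‖zetaBlaschke z‖ * Δ g z = 0 := by
  have log_norm_harmonic : HarmonicOnNhd (fun z : ℂ ↦ Real.log ‖z‖) (closedBall 1 (1 / 3)) :=
    fun z hz ↦ analyticAt_id.harmonicAt_log_norm
      (ne_zero_of_re_pos (lt_re_of_mem_closedBall (by norm_num) hz))
  rw [setIntegral_ball_mul_laplacian (R := 1 / 3) (k := -1) (by norm_num) (by norm_num)
    harmonicOnNhd_log_norm_zetaBlaschke log_norm_harmonic hg.contDiff fun z hz ↦ ?_]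
  · simp [zetaBlaschke_one]
  · have hsupp : z ∈ tsupport (boxCutoff S) := subset_tsupport _ (by
      rw [Function.mem_support,
        (boxCutoff_eventuallyEq_one_of_mem_closedBall hS hz.1).eq_of_nhds]
      exact one_ne_zero)
    have hre : 1 / 2 ≤ z.re := (lt_re_of_mem_closedBall (by norm_num) hz.1).le
    filter_upwards [hg.eventuallyEq z hsupp hre hz.2] with w hw
    rw [hw, logRatio_eq_sub, neg_one_mul, sub_eq_add_neg]

theorem integral_boundary (hS : 2 ≤ S) :
    ∫ y : ℝ, (Real.log ‖zetaBlaschke ((1 / 2 : ℝ) + y * I)‖ + g ((1 / 2 : ℝ) + y * I)) *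
      fderiv ℝ (fun z ↦ boxCutoff S z * g z) ((1 / 2 : ℝ) + y * I) 1 =
    ∫ y, cutoff S y * integrand y := by
  have zeros_countable : {y : ℝ | riemannZeta (1 / 2 + y * I) = 0}.Countable :=
    countable_riemannZetaZeros.preimage_of_injOn (f := fun y : ℝ ↦ (1 / 2 + y * I : ℂ))
      (fun x _ y _ h ↦ by simpa using h)
  refine integral_congr_ae ?_
  filter_upwards [zeros_countable.ae_notMem volume] with y hy
  obtain ⟨h0, h1⟩ := half_add_ne_zero_and_ne_one y
  push_cast
  rw [hg.fderiv_boxCutoff_mul hS]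
  by_cases hsupp : (1 / 2 + y * I : ℂ) ∈ tsupport (boxCutoff S)
  · rw [(hg.eventuallyEq _ hsupp (by simp) (half_add_notMem_ball y)).eq_of_nhds,
      ← log_norm_riemannZeta_eq h0 h1 hy, integrand]
    ring
  · rw [← boxCutoff_half_add (by linarith), image_eq_zero_of_notMem_tsupport hsupp]
    ring

theorem setIntegral_ball (hS : 2 ≤ S) :
    ∫ z in ball 1 (1 / 4), (Real.log ‖zetaBlaschke z‖ + g z) *
      Δ (fun z ↦ boxCutoff S z * g z) z = ∫ z in ball 1 (1 / 4), g z * Δ g z := by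
  have laplacian_eq : ∀ z ∈ ball 1 (1 / 4), (Real.log ‖zetaBlaschke z‖ + g z) *
      Δ (fun z ↦ boxCutoff S z * g z) z =
      Real.log ‖zetaBlaschke z‖ * Δ g z + g z * Δ g z := fun z hz ↦ by
    have : (fun z ↦ boxCutoff S z * g z) =ᶠ[𝓝 z] g := by
      filter_upwards [boxCutoff_eventuallyEq_one_of_mem_closedBall hS
        (ball_one_subset_closedBall hz)] with w hw
      rw [hw, one_mul]
    rw [(laplacian_congr_nhds this).eq_of_nhds, add_mul]
  have integrable {f : ℂ → ℝ} (hf : ContinuousOn f (closedBall 1 (1 / 3))) :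
      IntegrableOn (fun z ↦ f z * Δ g z) (ball 1 (1 / 4)) :=
    ((hf.mul (continuous_laplacian hg.contDiff).continuousOn).integrableOn_compact
      (isCompact_closedBall _ _)).mono_set ball_one_subset_closedBall
  rw [setIntegral_congr_fun measurableSet_ball laplacian_eq,
    integral_add (integrable harmonicOnNhd_log_norm_zetaBlaschke.continuousOn)
      (integrable hg.contDiff.continuous.continuousOn),
    hg.setIntegral_log_norm_zetaBlaschke_mul hS, zero_add]

theorem setIntegral_halfPlane_sdiff (hS : 2 ≤ S) :
    ∫ z in {z : ℂ | 1 / 2 < z.re} \ ball 1 (1 / 4), (Real.log ‖zetaBlaschke z‖ + g z) *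
      Δ (fun z ↦ boxCutoff S z * g z) z = ∫ z in {z : ℂ | 1 / 2 < z.re},
      Real.log ‖riemannZeta z‖ * laplacianCommutator (boxCutoff S) logRatio z := by
  have hH : MeasurableSet {z : ℂ | 1 / 2 < z.re} := measurableSet_halfPlane _
  rw [setIntegral_eq_of_subset_of_forall_sdiff_eq_zero hH sdiff_subset fun z hz ↦ ?_]
  · refine setIntegral_congr_ae (hH.diff measurableSet_ball) ?_
    filter_upwards [countable_riemannZetaZeros.ae_notMem volume] with z hζ hz
    have hre : 1 / 2 ≤ z.re := le_of_lt hz.1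
    have h1 : z ≠ 1 := fun h ↦ hz.2 (h ▸ mem_ball_self (by norm_num))
    rw [hg.laplacian_boxCutoff_mul_of_notMem_ball hre hz.2]
    by_cases hsupp : z ∈ tsupport (boxCutoff S)
    · rw [(hg.eventuallyEq z hsupp hre hz.2).eq_of_nhds, ← log_norm_riemannZeta_eq
        (ne_zero_of_re_pos (one_half_pos.trans_le hre)) h1 hζ]
    · rw [laplacianCommutator_eq_zero (notMem_tsupport_iff_eventuallyEq.1 hsupp), mul_zero,
        mul_zero]
  · have hball : z ∈ ball 1 (1 / 4) := by_contra fun h ↦ hz.2 ⟨hz.1, h⟩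
    rw [laplacianCommutator_eq_zero (boxCutoff_eventuallyEq_one_of_mem_closedBall hS
      (ball_one_subset_closedBall hball)), mul_zero]

theorem setIntegral_halfPlane (hS : 2 ≤ S)
    (hint : IntegrableOn (fun z ↦ (Real.log ‖zetaBlaschke z‖ + g z) *
      Δ (fun z ↦ boxCutoff S z * g z) z) {z : ℂ | 1 / 2 < z.re}) :
    ∫ z in {z : ℂ | 1 / 2 < z.re}, (Real.log ‖zetaBlaschke z‖ + g z) *
      Δ (fun z ↦ boxCutoff S z * g z) z =
    (∫ z in ball 1 (1 / 4), g z * Δ g z) + ∫ z in {z : ℂ | 1 / 2 < z.re},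
      Real.log ‖riemannZeta z‖ * laplacianCommutator (boxCutoff S) logRatio z := by
  rw [← integral_inter_add_sdiff measurableSet_ball hint,
    inter_eq_right.2 ball_one_subset_halfPlane, hg.setIntegral_ball hS,
    hg.setIntegral_halfPlane_sdiff hS]

theorem finsum_analyticOrderNatAt_zetaBlaschke (hS : 2 ≤ S) :
    ∑ᶠ ρ, analyticOrderNatAt zetaBlaschke ρ *
      {z : ℂ | 1 / 2 < z.re}.indicator (fun z ↦ boxCutoff S z * g z) ρ = smoothedZeroSum S := by
  rw [smoothedZeroSum, finsum_eq_sum_of_support_subset]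
  · refine Finset.sum_congr rfl fun ρ hρ ↦ ?_
    obtain ⟨⟨hζ, h0, h1⟩, -, hre⟩ := (Finite.mem_toFinset _).1 hρ
    have hρ1 : ρ ≠ 1 := fun h ↦ by simp [h] at h1
    have hball : ρ ∉ ball 1 (1 / 4) := fun h ↦
      zetaBlaschke_ne_zero_of_mem_closedBall (ball_one_subset_closedBall h)
        (by rw [zetaBlaschke_eq hρ1, hζ, mul_zero])
    rw [analyticOrderNatAt_zetaBlaschke (ne_zero_of_re_pos h0) hρ1, indicator_of_mem (by exact hre),
      (hg.boxCutoff_mul_eventuallyEq (le_of_lt hre) hball).eq_of_nhds, boxCutoff,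
      cutoff_eq_one (y := ρ.re) (by rw [abs_of_pos h0]; linarith), one_mul]
  · intro ρ hρ
    have hre : 1 / 2 < ρ.re := mem_of_indicator_ne_zero (s := {z : ℂ | 1 / 2 < z.re})
      (right_ne_zero_of_mul hρ)
    have hF : zetaBlaschke ρ = 0 := by
      by_contra h
      refine left_ne_zero_of_mul hρ ?_
      rw [analyticOrderNatAt, (analyticAt_zetaBlaschke
        (ne_zero_of_re_pos (one_half_pos.trans hre))).analyticOrderAt_eq_zero.2 h]
      simp
    have him : ρ.im ∈ Icc (-(S + 1)) (S + 1) := by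
      have hφ := right_ne_zero_of_mul hρ
      rw [indicator_of_mem (by exact hre)] at hφ
      exact (tsupport_boxCutoff_subset (by linarith)
        (subset_tsupport _ (left_ne_zero_of_mul hφ))).2
    exact (Finite.mem_toFinset _).2 (mem_zerosRightOfLine hre him hF)

end IsSmoothing

theorem integral_cutoff_mul_integrand_add (hS : 2 ≤ S) :
    (∫ y, cutoff S y * integrand y) + ∫ z in {z : ℂ | 1 / 2 < z.re},
      Real.log ‖riemannZeta z‖ * laplacianCommutator (boxCutoff S) logRatio z =
    2 * Real.pi * smoothedZeroSum S := by
  obtain ⟨g, hg⟩ := exists_isSmoothing (S := S) (by linarith)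
  have hφ := hg.isTestFunction (by linarith)
  have green := (GreenIdentity.log_norm (f := zetaBlaschke) hφ
    (fun z hz ↦ analyticAt_zetaBlaschke (ne_zero_of_re_pos (one_half_pos.trans_le hz.2)))
    fun z hz ↦ analyticOrderAt_zetaBlaschke_ne_top (one_half_pos.trans_le hz.2)).add
      (.of_contDiff hφ hg.contDiff)
  have identity := green.integral_add_setIntegral
  rw [hg.integral_boundary hS, hg.setIntegral_halfPlane hS green.integrableOn,
    hg.setIntegral_boxCutoff_mul hS, hg.finsum_analyticOrderNatAt_zetaBlaschke hS] at identity
  linarith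

end Identity

section Frame

theorem setIntegral_union_le {X : Type*} [MeasurableSpace X] {μ : Measure X} {f : X → ℝ}
    {s t : Set X} (hf : ∀ x, 0 ≤ f x) (hs : IntegrableOn f s μ) (ht : IntegrableOn f t μ) :
    ∫ x in s ∪ t, f x ∂μ ≤ (∫ x in s, f x ∂μ) + ∫ x in t, f x ∂μ := by
  rw [← integral_add_measure hs ht]
  exact integral_mono_measure (Measure.restrict_union_le s t) (.of_forall hf)
    (Integrable.add_measure hs ht)

theorem setIntegral_reProdIm_rpow {a : ℝ} (ha : 0 < a) {t : Set ℝ} (hfin : volume t ≠ ⊤) :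
    IntegrableOn (fun z : ℂ ↦ z.re ^ (-2 : ℝ)) (Ici a ×ℂ t) ∧
      ∫ z in Ici a ×ℂ t, z.re ^ (-2 : ℝ) = volume.real t / a := by
  have mp := Complex.volume_preserving_equiv_real_prod
  have emb := Complex.measurableEquivRealProd.measurableEmbedding
  have preimage : Ici a ×ℂ t = Complex.measurableEquivRealProd ⁻¹' (Ici a ×ˢ t) := by
    ext z
    simp [Complex.measurableEquivRealProd, Complex.mem_reProdIm]
  have power : IntegrableOn (fun x : ℝ ↦ x ^ (-2 : ℝ)) (Ici a) :=
    (integrableOn_Ici_iff_integrableOn_Ioi (by simp)).2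
      (integrableOn_Ioi_rpow_of_lt (by norm_num) ha)
  have one : IntegrableOn (fun _ : ℝ ↦ (1 : ℝ)) t := integrableOn_const hfin
  have prod : IntegrableOn (fun p : ℝ × ℝ ↦ p.1 ^ (-2 : ℝ) * 1) (Ici a ×ˢ t) := by
    rw [IntegrableOn, Measure.volume_eq_prod, ← Measure.prod_restrict]
    exact power.mul_prod one
  have comp (z : ℂ) :
      z.re ^ (-2 : ℝ) = (Complex.measurableEquivRealProd z).1 ^ (-2 : ℝ) * 1 := by
    simp [Complex.measurableEquivRealProd]
  simp_rw [preimage, comp]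
  refine ⟨(mp.integrableOn_comp_preimage emb).2 prod, ?_⟩
  rw [mp.setIntegral_preimage_emb emb (fun p : ℝ × ℝ ↦ p.1 ^ (-2 : ℝ) * 1),
    Measure.volume_eq_prod, setIntegral_prod_mul (fun x : ℝ ↦ x ^ (-2 : ℝ)) (fun _ ↦ (1 : ℝ)),
    integral_Ici_eq_integral_Ioi,
    integral_Ioi_rpow_of_lt (by norm_num) ha, setIntegral_const, smul_eq_mul]
  norm_num
  rw [Real.rpow_neg_one]
  ring

theorem setIntegral_reProdIm_log_norm_riemannZeta_le {a : ℝ} (ha : 2 ≤ a) {t : Set ℝ}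
    (ht : MeasurableSet t) (hfin : volume t ≠ ⊤) :
    IntegrableOn (fun z ↦ |Real.log ‖riemannZeta z‖| * |z.re|) (Ici a ×ℂ t) ∧
      ∫ z in Ici a ×ℂ t, |Real.log ‖riemannZeta z‖| * |z.re| ≤ 128 * (volume.real t / a) := by
  have hs : MeasurableSet (Ici a ×ℂ t) := 
    (Complex.measurable_re measurableSet_Ici).inter (Complex.measurable_im ht)
  obtain ⟨power_integrable, power_integral⟩ := setIntegral_reProdIm_rpow (by linarith) hfin
  have bound : ∀ z ∈ Ici a ×ℂ t,
      |Real.log ‖riemannZeta z‖| * |z.re| ≤ 128 * z.re ^ (-2 : ℝ) := fun z hz ↦ by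
    have hre : 2 ≤ z.re := ha.trans hz.1
    calc |Real.log ‖riemannZeta z‖| * |z.re| ≤ 128 / z.re ^ 3 * z.re := by
          rw [abs_of_nonneg (show 0 ≤ z.re by linarith)]
          gcongr
          exact abs_log_norm_riemannZeta_le hre
      _ = 128 * z.re ^ (-2 : ℝ) := by
          rw [Real.rpow_neg (by linarith), Real.rpow_two]
          field_simp
  have continuousOn : ContinuousOn (fun z ↦ |Real.log ‖riemannZeta z‖| * |z.re|) (Ici a ×ℂ t) :=
    fun z hz ↦ by
      have hre : 1 < z.re := one_lt_two.trans_le (ha.trans hz.1)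
      have h1 : z ≠ 1 := by rintro rfl; simp at hre
      exact (((analyticAt_riemannZeta h1).continuousAt.norm.log (norm_ne_zero_iff.2
        (riemannZeta_ne_zero_of_one_le_re hre.le))).abs.mul
        Complex.continuous_re.continuousAt.abs).continuousWithinAt
  have integrable : IntegrableOn (fun z ↦ |Real.log ‖riemannZeta z‖| * |z.re|) (Ici a ×ℂ t) := by
    refine (power_integrable.const_mul 128).mono' (continuousOn.aestronglyMeasurable hs) ?_
    filter_upwards [ae_restrict_mem hs] with z hz
    rw [Real.norm_of_nonneg (by positivity)]
    exact bound z hz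
  refine ⟨integrable, ?_⟩
  rw [← power_integral, ← integral_const_mul]
  exact setIntegral_mono_on integrable (power_integrable.const_mul 128) hs bound

theorem log_norm_riemannZeta_le {S : ℝ} (hS : 2 ≤ S) {z : ℂ} (hre : 1 / 8 < z.re)
    (h1 : 1 / 4 ≤ ‖z - 1‖) (hz : ‖z‖ ≤ 5 * S) : Real.log ‖riemannZeta z‖ ≤ 7 * Real.log S := by
  have log_nonneg : 0 ≤ Real.log S := Real.log_nonneg (by linarith)
  rcases eq_or_ne (riemannZeta z) 0 with hζ | hζ
  · rw [hζ, norm_zero, Real.log_zero]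
    positivity
  have hz1 : z ≠ 1 := by rintro rfl; norm_num at h1
  have norm_le : ‖riemannZeta z‖ ≤ S ^ 7 :=
    calc ‖riemannZeta z‖ ≤ ‖z‖ * (1 / ‖z - 1‖ + 1 / z.re) :=
          norm_riemannZeta_le (by linarith) hz1
      _ ≤ 5 * S * (1 / (1 / 4) + 1 / (1 / 8)) := by gcongr
      _ ≤ S ^ 6 * S := by
          have : (2 : ℝ) ^ 6 ≤ S ^ 6 := by gcongr
          nlinarith
      _ = S ^ 7 := by ring
  calc Real.log ‖riemannZeta z‖ ≤ Real.log (S ^ 7) := Real.log_le_log (by simpa using hζ) norm_le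
    _ = 7 * Real.log S := by rw [Real.log_pow]; norm_num

section FrameBall

variable {S : ℝ} {c z : ℂ} (hS : 2 ≤ S) (hre : c.re = 3) (him : |c.im| = S + 1 / 2)

include hre

theorem abs_re_le_of_mem_closedBall (hz : z ∈ closedBall c (11 / 4)) : |z.re| ≤ 6 := by
  have := (Complex.abs_re_le_norm (z - c)).trans (mem_closedBall_iff_norm.1 hz)
  rw [Complex.sub_re, hre, abs_le] at this
  exact abs_le.2 ⟨by linarith, by linarith⟩

include hS him

theorem quarter_le_norm_sub_one (hz : z ∈ closedBall c (11 / 4)) : 1 / 4 ≤ ‖z - 1‖ := by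
  have center : 3 ^ 2 ≤ ‖c - 1‖ ^ 2 := by
    rw [Complex.sq_norm, Complex.normSq_apply, Complex.sub_re, Complex.sub_im, hre,
      Complex.one_re, Complex.one_im, sub_zero, ← sq, ← sq, ← sq_abs c.im, him]
    nlinarith
  have := mem_closedBall_iff_norm'.1 hz
  linarith [norm_sub_le_norm_sub_add_norm_sub c z 1, le_of_sq_le_sq center (norm_nonneg _)]

theorem norm_le_of_mem_closedBall (hz : z ∈ closedBall c (11 / 4)) : ‖z‖ ≤ 5 * S := by
  have center := Complex.norm_le_abs_re_add_abs_im c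
  rw [hre, him, abs_of_pos three_pos] at center
  linarith [norm_le_norm_add_norm_sub' z c, mem_closedBall_iff_norm.1 hz]

theorem analyticOnNhd_riemannZeta_closedBall :
    AnalyticOnNhd ℂ riemannZeta (closedBall c (11 / 4)) := fun z hz ↦
  analyticAt_riemannZeta fun h ↦ by
    have := quarter_le_norm_sub_one hS hre him hz
    norm_num [h] at this

theorem setIntegral_ball_abs_log_norm_riemannZeta_le :
    ∫ z in ball c (11 / 4), |Real.log ‖riemannZeta z‖| ≤
      Real.pi * (11 / 4) ^ 2 * (24 * Real.log S) := by
  have half_le : 1 / 2 ≤ Real.log S := by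
    linarith [Real.log_two_gt_d9, Real.log_le_log two_pos hS]
  have hc : riemannZeta c ≠ 0 := riemannZeta_ne_zero_of_one_le_re (by rw [hre]; norm_num)
  have center_le : -Real.log ‖riemannZeta c‖ ≤ 10 * Real.log S := by
    have := abs_log_norm_riemannZeta_le (s := c) (by rw [hre]; norm_num)
    rw [hre] at this
    linarith [neg_le_abs (Real.log ‖riemannZeta c‖)]
  refine (setIntegral_abs_log_norm_le (M := 7 * Real.log S) (by norm_num) (by positivity)
    (analyticOnNhd_riemannZeta_closedBall hS hre him) hc fun z hz ↦ ?_).trans ?_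
  · have hz' := ball_subset_closedBall hz
    exact log_norm_riemannZeta_le hS (lt_re_of_mem_closedBall (by rw [hre]; norm_num) hz')
      (quarter_le_norm_sub_one hS hre him hz') (norm_le_of_mem_closedBall hS hre him hz')
  · gcongr
    linarith

theorem setIntegral_ball_log_norm_riemannZeta_mul_le :
    IntegrableOn (fun z ↦ |Real.log ‖riemannZeta z‖| * |z.re|) (ball c (11 / 4)) ∧
      ∫ z in ball c (11 / 4), |Real.log ‖riemannZeta z‖| * |z.re| ≤ 5000 * Real.log S := by
  have hc : riemannZeta c ≠ 0 := riemannZeta_ne_zero_of_one_le_re (by rw [hre]; norm_num)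
  have integrable : IntegrableOn (fun z ↦ |Real.log ‖riemannZeta z‖|) (ball c (11 / 4)) :=
    IntegrableOn.mono_set (integrableOn_log_norm_closedBall (by norm_num)
      (analyticOnNhd_riemannZeta_closedBall hS hre him) hc).abs ball_subset_closedBall
  have re_aestronglyMeasurable : AEStronglyMeasurable (fun z : ℂ ↦ |z.re|)
      (volume.restrict (ball c (11 / 4))) := Complex.continuous_re.abs.aestronglyMeasurable
  have weighted : IntegrableOn (fun z ↦ |Real.log ‖riemannZeta z‖| * |z.re|) (ball c (11 / 4)) := by
    refine Integrable.mul_bdd (c := 6) integrable re_aestronglyMeasurable ?_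
    filter_upwards [ae_restrict_mem measurableSet_ball] with z hz
    rw [Real.norm_eq_abs, abs_abs]
    exact abs_re_le_of_mem_closedBall hre (ball_subset_closedBall hz)
  refine ⟨weighted, ?_⟩
  have log_nonneg : 0 ≤ Real.log S := Real.log_nonneg (one_le_two.trans hS)
  calc ∫ z in ball c (11 / 4), |Real.log ‖riemannZeta z‖| * |z.re|
      ≤ ∫ z in ball c (11 / 4), |Real.log ‖riemannZeta z‖| * 6 :=
        setIntegral_mono_on weighted (integrable.mul_const 6) measurableSet_ball fun z hz ↦ by
          gcongr
          exact abs_re_le_of_mem_closedBall hre (ball_subset_closedBall hz)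
    _ ≤ Real.pi * (11 / 4) ^ 2 * (24 * Real.log S) * 6 := by
        rw [integral_mul_const]
        gcongr
        exact setIntegral_ball_abs_log_norm_riemannZeta_le hS hre him
    _ ≤ 4 * (11 / 4) ^ 2 * (24 * Real.log S) * 6 := by
        gcongr
        exact Real.pi_le_four
    _ ≤ 5000 * Real.log S := by linarith

end FrameBall

theorem measurableSet_frame (S : ℝ) : MeasurableSet (frame S) := by
  have re := Complex.measurable_re.abs
  have im := Complex.measurable_im.abs
  exact (measurableSet_le re measurable_const).inter ((measurableSet_le im measurable_const).inter
    ((measurableSet_le measurable_const re).union (measurableSet_le measurable_const im)))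

theorem frame_inter_halfPlane_subset {S : ℝ} (hS : 2 ≤ S) :
    frame S ∩ {z : ℂ | 1 / 2 < z.re} ⊆
      (ball ⟨3, S + 1 / 2⟩ (11 / 4) ∪ ball ⟨3, -(S + 1 / 2)⟩ (11 / 4)) ∪
      (Ici 2 ×ℂ (Icc (-(S + 1)) (-S) ∪ Icc S (S + 1)) ∪ Ici S ×ℂ Icc (-(S + 1)) (S + 1)) := by
  rintro z ⟨⟨-, him, hfar⟩, hhalf⟩
  replace hhalf : 1 / 2 < z.re := hhalf
  rw [abs_of_pos (one_half_pos.trans hhalf)] at hfar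
  have mem_ball {y : ℝ} (h2 : z.re < 2) (hy : |z.im - y| ≤ 1 / 2) : z ∈ ball ⟨3, y⟩ (11 / 4) := by
    rw [mem_ball_iff_norm]
    refine lt_of_pow_lt_pow_left₀ 2 (by norm_num) ?_
    rw [Complex.sq_norm, Complex.normSq_apply]
    simp only [Complex.sub_re, Complex.sub_im]
    nlinarith [abs_le.1 hy]
  have far_im (h : S ≤ |z.im|) : z.im ∈ Icc (-(S + 1)) (-S) ∪ Icc S (S + 1) := by
    rcases le_abs'.1 h with h | h
    · exact .inl ⟨(abs_le.1 him).1, h⟩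
    · exact .inr ⟨h, (abs_le.1 him).2⟩
  rcases lt_or_ge z.re 2 with h2 | h2
  · rcases far_im (hfar.resolve_left (by linarith)) with ⟨hl, hr⟩ | ⟨hl, hr⟩
    · exact .inl (.inr (mem_ball h2 (abs_le.2 ⟨by linarith, by linarith⟩)))
    · exact .inl (.inl (mem_ball h2 (abs_le.2 ⟨by linarith, by linarith⟩)))
  · rcases hfar with hre | hfar
    · exact .inr (.inr ⟨hre, abs_le.1 him⟩)
    · exact .inr (.inl ⟨h2, far_im hfar⟩)

theorem setIntegral_frame_log_norm_riemannZeta_mul_le {S : ℝ} (hS : 2 ≤ S) :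
    IntegrableOn (fun z ↦ |Real.log ‖riemannZeta z‖| * |z.re|)
        (frame S ∩ {z : ℂ | 1 / 2 < z.re}) ∧
      ∫ z in frame S ∩ {z : ℂ | 1 / 2 < z.re}, |Real.log ‖riemannZeta z‖| * |z.re| ≤
        11000 * Real.log S := by
  have half_le : 3 / 5 ≤ Real.log S := by
    linarith [Real.log_two_gt_d9, Real.log_le_log two_pos hS]
  have pos : 0 ≤ S + 1 / 2 := by linarith
  obtain ⟨upper, upper_le⟩ := setIntegral_ball_log_norm_riemannZeta_mul_le hS
    (c := ⟨3, S + 1 / 2⟩) rfl (abs_of_nonneg pos)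
  obtain ⟨lower, lower_le⟩ := setIntegral_ball_log_norm_riemannZeta_mul_le hS
    (c := ⟨3, -(S + 1 / 2)⟩) rfl (by rw [abs_neg, abs_of_nonneg pos])
  obtain ⟨strips, strips_le⟩ := setIntegral_reProdIm_log_norm_riemannZeta_le le_rfl
    (measurableSet_Icc.union measurableSet_Icc) (isCompact_Icc.union isCompact_Icc).measure_ne_top
    (t := Icc (-(S + 1)) (-S) ∪ Icc S (S + 1))
  obtain ⟨right, right_le⟩ := setIntegral_reProdIm_log_norm_riemannZeta_le hS
    measurableSet_Icc isCompact_Icc.measure_ne_top (t := Icc (-(S + 1)) (S + 1))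
  have strips_volume : volume.real (Icc (-(S + 1)) (-S) ∪ Icc S (S + 1)) ≤ 2 := by
    refine (measureReal_union_le _ _).trans ?_
    rw [Real.volume_real_Icc_of_le (by linarith), Real.volume_real_Icc_of_le (by linarith)]
    linarith
  have right_volume : volume.real (Icc (-(S + 1)) (S + 1)) / S ≤ 3 := by
    rw [Real.volume_real_Icc_of_le (by linarith), div_le_iff₀ (by linarith)]
    linarith
  have nonneg (z : ℂ) : 0 ≤ |Real.log ‖riemannZeta z‖| * |z.re| := by positivity
  have integrable := (upper.union lower).union (strips.union right)
  refine ⟨integrable.mono_set (frame_inter_halfPlane_subset hS), ?_⟩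
  refine (setIntegral_mono_set integrable (.of_forall nonneg)
    (frame_inter_halfPlane_subset hS).eventuallyLE).trans ?_
  linarith [setIntegral_union_le nonneg upper lower, setIntegral_union_le nonneg strips right,
    setIntegral_union_le nonneg (upper.union lower) (strips.union right)]

theorem exists_abs_integral_cutoff_sub_le : ∃ C, 0 ≤ C ∧ ∀ S, 2 ≤ S →
    |(∫ y, cutoff S y * integrand y) - 2 * Real.pi * smoothedZeroSum S| ≤
      C * (Real.log S / S ^ 2) := by
  obtain ⟨C, hC, commutator_le⟩ := exists_abs_laplacianCommutator_boxCutoff_le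
  refine ⟨C * 11000, by positivity, fun S hS ↦ ?_⟩
  obtain ⟨integrable, frame_le⟩ := setIntegral_frame_log_norm_riemannZeta_mul_le hS
  have frame_measurable : MeasurableSet (frame S ∩ {z : ℂ | 1 / 2 < z.re}) :=
    (measurableSet_frame S).inter (measurableSet_halfPlane _)
  rw [← integral_cutoff_mul_integrand_add hS, sub_add_cancel_left, abs_neg,
    setIntegral_eq_of_subset_of_forall_sdiff_eq_zero (measurableSet_halfPlane _)
      (inter_subset_right (s := frame S)) fun z hz ↦ by
        rw [laplacianCommutator_boxCutoff_eq_zero (by linarith) fun h ↦ hz.2 ⟨h, hz.1⟩, mul_zero]]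
  calc |∫ z in frame S ∩ {z : ℂ | 1 / 2 < z.re},
        Real.log ‖riemannZeta z‖ * laplacianCommutator (boxCutoff S) logRatio z|
      ≤ ∫ z in frame S ∩ {z : ℂ | 1 / 2 < z.re},
        C / S ^ 2 * (|Real.log ‖riemannZeta z‖| * |z.re|) := by
        rw [← Real.norm_eq_abs]
        refine norm_integral_le_of_norm_le (integrable.const_mul _) ?_
        filter_upwards [ae_restrict_mem frame_measurable] with z hz
        have hre : 1 / 2 < z.re := hz.2
        rw [Real.norm_eq_abs, abs_mul, mul_left_comm, abs_of_pos (one_half_pos.trans hre)]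
        gcongr
        exact commutator_le S hS z hz.1 hre.le
    _ ≤ C / S ^ 2 * (11000 * Real.log S) := by
        rw [integral_const_mul]
        gcongr
    _ = C * 11000 * (Real.log S / S ^ 2) := by ring

end Frame

section Truncation

theorem intervalIntegrable_integrand (a b : ℝ) : IntervalIntegrable integrand volume a b := by
  have analytic : ∀ y ∈ uIcc a b, AnalyticAt ℝ (fun y : ℝ ↦ riemannZeta (1 / 2 + y * I)) y :=
    fun y _ ↦ (analyticAt_riemannZeta (half_add_ne_zero_and_ne_one y).2).restrictScalars.comp
      (f := fun y : ℝ ↦ (1 / 2 + y * I : ℂ))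
      (analyticAt_const.add ((Complex.ofRealCLM.analyticAt y).mul analyticAt_const))
  have log_norm := MeromorphicOn.intervalIntegrable_log_norm fun y hy ↦
    (analytic y hy).meromorphicAt
  refine log_norm.mul_continuousOn (g := fun y : ℝ ↦ (1 / 4 + y ^ 2)⁻¹)
    (ContinuousOn.inv₀ (by fun_prop) fun y _ ↦ by positivity)

theorem integrand_le {T y : ℝ} (hT : 3 ≤ T) (hl : T - 1 ≤ |y|) (hu : |y| ≤ T + 1) :
    integrand y ≤ 16 * (Real.log T / T ^ 2) := by
  have log_le : Real.log ‖riemannZeta (1 / 2 + y * I)‖ ≤ 7 * Real.log T := by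
    have norm_le : ‖(1 / 2 + y * I : ℂ)‖ ≤ 1 / 2 + |y| := by
      simpa using norm_add_le (1 / 2 : ℂ) (y * I)
    have norm_sub_one : 1 / 4 ≤ ‖(1 / 2 + y * I : ℂ) - 1‖ :=
      not_lt.1 fun h ↦ half_add_notMem_ball y (mem_ball_iff_norm.2 h)
    exact log_norm_riemannZeta_le (by linarith) (by norm_num) norm_sub_one (by linarith)
  have sq_le : 7 / 16 * T ^ 2 ≤ 1 / 4 + y ^ 2 := by
    rw [← sq_abs y]
    nlinarith
  have log_nonneg : 0 ≤ Real.log T := Real.log_nonneg (by linarith)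
  calc integrand y ≤ 7 * Real.log T / (7 / 16 * T ^ 2) :=
        div_le_div₀ (by positivity) log_le (by positivity) sq_le
    _ = 16 * (Real.log T / T ^ 2) := by ring

variable {T : ℝ} {w : ℝ → ℝ}

theorem integrable_mul_integrand (hw : AEStronglyMeasurable w) (h1 : ∀ y, |w y| ≤ 1)
    (h0 : ∀ y, T < |y| → w y = 0) : Integrable fun y ↦ w y * integrand y := by
  have support : Function.support (fun y ↦ w y * integrand y) ⊆ Icc (-T) T := fun y hy ↦
    abs_le.1 (not_lt.1 fun h ↦ left_ne_zero_of_mul hy (h0 y h))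
  rw [← integrableOn_iff_integrable_of_support_subset support]
  refine Integrable.bdd_mul (c := 1) ?_ hw.restrict (.of_forall h1)
  exact IntegrableOn.mono_set ((intervalIntegrable_iff' (by simp)).1
    (intervalIntegrable_integrand _ _)) Icc_subset_uIcc

theorem abs_preimage_Icc_subset (a b : ℝ) : abs ⁻¹' Icc a b ⊆ Icc (-b) (-a) ∪ Icc a b :=
  fun _ ⟨hl, hu⟩ ↦ (le_abs'.1 hl).imp (fun h ↦ ⟨(abs_le.1 hu).1, h⟩) fun h ↦ ⟨h, (abs_le.1 hu).2⟩

theorem integral_mul_integrand_le (hT : 3 ≤ T) (hw : AEStronglyMeasurable w)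
    (hw01 : ∀ y, w y ∈ Icc 0 1) (hw0 : ∀ y, |y| ∉ Icc (T - 1) (T + 1) → w y = 0) :
    ∫ y, w y * integrand y ≤ 64 * (Real.log T / T ^ 2) := by
  have log_nonneg : 0 ≤ Real.log T := Real.log_nonneg (by linarith)
  have two_intervals : volume (Icc (-(T + 1)) (-(T - 1)) ∪ Icc (T - 1) (T + 1)) ≠ ⊤ :=
    (isCompact_Icc.union isCompact_Icc).measure_ne_top
  have volume_le : volume.real (abs ⁻¹' Icc (T - 1) (T + 1)) ≤ 4 := by
    refine (measureReal_mono (abs_preimage_Icc_subset _ _) two_intervals).trans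
      ((measureReal_union_le _ _).trans ?_)
    rw [Real.volume_real_Icc_of_le (by linarith), Real.volume_real_Icc_of_le (by linarith)]
    linarith
  have integrable := integrable_mul_integrand hw (fun y ↦ abs_le.2
    ⟨by linarith [(hw01 y).1], (hw01 y).2⟩) fun y hy ↦ hw0 y fun h ↦ hy.not_ge h.2
  calc ∫ y, w y * integrand y = ∫ y in abs ⁻¹' Icc (T - 1) (T + 1), w y * integrand y :=
        (setIntegral_eq_integral_of_forall_compl_eq_zero fun y hy ↦ by
          rw [hw0 y hy, zero_mul]).symm
    _ ≤ ∫ _ in abs ⁻¹' Icc (T - 1) (T + 1), 16 * (Real.log T / T ^ 2) := by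
        refine setIntegral_mono_on integrable.integrableOn (integrableOn_const
          (measure_ne_top_of_subset (abs_preimage_Icc_subset _ _) two_intervals))
          (measurable_abs measurableSet_Icc) fun y hy ↦ ?_
        calc w y * integrand y ≤ w y * (16 * (Real.log T / T ^ 2)) :=
              mul_le_mul_of_nonneg_left (integrand_le hT hy.1 hy.2) (hw01 y).1
          _ ≤ 16 * (Real.log T / T ^ 2) := mul_le_of_le_one_left (by positivity) (hw01 y).2
    _ = volume.real (abs ⁻¹' Icc (T - 1) (T + 1)) * (16 * (Real.log T / T ^ 2)) := by
        rw [setIntegral_const, smul_eq_mul]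
    _ ≤ 4 * (16 * (Real.log T / T ^ 2)) := by gcongr
    _ = 64 * (Real.log T / T ^ 2) := by ring

theorem truncatedIntegral_eq (hT : 0 ≤ T) :
    truncatedIntegral T = ∫ y, (Icc (-T) T).indicator 1 y * integrand y := by
  rw [truncatedIntegral, intervalIntegral.integral_of_le (by linarith),
    ← integral_Icc_eq_integral_Ioc, ← integral_indicator measurableSet_Icc]
  congr with y
  rw [← indicator_mul_left]
  simp

theorem aestronglyMeasurable_cutoff (S : ℝ) : AEStronglyMeasurable (cutoff S) :=
  (contDiff_cutoff S (n := 0)).continuous.aestronglyMeasurable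

theorem integrable_cutoff_mul_integrand {S : ℝ} (hS : 0 ≤ S) :
    Integrable fun y ↦ cutoff S y * integrand y :=
  integrable_mul_integrand (aestronglyMeasurable_cutoff S)
    (abs_cutoff_le_one hS) fun _ hy ↦ cutoff_eq_zero hS hy.le

theorem indicator_Icc_of_abs_le {y : ℝ} (hy : |y| ≤ T) :
    (Icc (-T) T).indicator (1 : ℝ → ℝ) y = 1 :=
  indicator_of_mem (by exact abs_le.1 hy) 1

theorem indicator_Icc_of_lt_abs {y : ℝ} (hy : T < |y|) :
    (Icc (-T) T).indicator (1 : ℝ → ℝ) y = 0 :=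
  indicator_of_notMem (fun h ↦ hy.not_ge (abs_le.2 h)) 1

theorem indicator_one_mem_Icc (s : Set ℝ) (y : ℝ) : s.indicator 1 y ∈ Icc (0 : ℝ) 1 :=
  ⟨indicator_nonneg (fun _ _ ↦ zero_le_one) y, indicator_le_self' (fun _ _ ↦ zero_le_one) y⟩

theorem aestronglyMeasurable_indicator_Icc (T : ℝ) :
    AEStronglyMeasurable ((Icc (-T) T).indicator (1 : ℝ → ℝ)) :=
  aestronglyMeasurable_one.indicator measurableSet_Icc

theorem integrable_indicator_mul_integrand (T : ℝ) :
    Integrable fun y ↦ (Icc (-T) T).indicator 1 y * integrand y := by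
  refine integrable_mul_integrand (aestronglyMeasurable_indicator_Icc T) (fun y ↦ ?_)
    fun y hy ↦ indicator_Icc_of_lt_abs hy
  obtain ⟨h0, h1⟩ := indicator_one_mem_Icc (Icc (-T) T) y
  exact abs_le.2 ⟨by linarith, h1⟩

theorem integral_cutoff_sub_truncatedIntegral_le (hT : 3 ≤ T) :
    (∫ y, cutoff T y * integrand y) - truncatedIntegral T ≤ 64 * (Real.log T / T ^ 2) := by
  have hT0 : 0 ≤ T := by linarith
  have indicator_le (y : ℝ) : (Icc (-T) T).indicator 1 y ≤ cutoff T y :=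
    indicator_le' (fun y hy ↦ (cutoff_eq_one (abs_le.2 hy)).ge) (fun y _ ↦ cutoff_nonneg hT0 y) y
  rw [truncatedIntegral_eq hT0, ← integral_sub (integrable_cutoff_mul_integrand hT0)
    (integrable_indicator_mul_integrand T)]
  simp_rw [← sub_mul]
  refine integral_mul_integrand_le hT ((aestronglyMeasurable_cutoff T).sub
    (aestronglyMeasurable_indicator_Icc T)) (fun y ↦ ⟨sub_nonneg.2 (indicator_le y), ?_⟩)
    fun y hy ↦ ?_
  · linarith [cutoff_le_one T y, (indicator_one_mem_Icc (Icc (-T) T) y).1]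
  · rcases le_or_gt |y| T with h | h
    · rw [cutoff_eq_one h, indicator_Icc_of_abs_le h, sub_self]
    · have : T + 1 ≤ |y| := le_of_not_ge fun h' ↦ hy ⟨by linarith, h'⟩
      rw [cutoff_eq_zero hT0 this, indicator_Icc_of_lt_abs h, sub_self]

theorem truncatedIntegral_sub_integral_cutoff_le (hT : 3 ≤ T) :
    truncatedIntegral T - ∫ y, cutoff (T - 1) y * integrand y ≤ 64 * (Real.log T / T ^ 2) := by
  have hT1 : 0 ≤ T - 1 := by linarith
  have cutoff_eq {y : ℝ} (hy : T < |y|) : cutoff (T - 1) y = 0 :=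
    cutoff_eq_zero hT1 (by linarith)
  have le_indicator (y : ℝ) : cutoff (T - 1) y ≤ (Icc (-T) T).indicator 1 y :=
    le_indicator_apply (fun _ ↦ cutoff_le_one _ y) fun h ↦
      (cutoff_eq (not_le.1 fun h' ↦ h (abs_le.1 h'))).le
  rw [truncatedIntegral_eq (by linarith), ← integral_sub (integrable_indicator_mul_integrand T)
    (integrable_cutoff_mul_integrand hT1)]
  simp_rw [← sub_mul]
  refine integral_mul_integrand_le hT ((aestronglyMeasurable_indicator_Icc T).sub
    (aestronglyMeasurable_cutoff _)) (fun y ↦ ⟨sub_nonneg.2 (le_indicator y), ?_⟩) fun y hy ↦ ?_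
  · linarith [cutoff_nonneg hT1 y, (indicator_one_mem_Icc (Icc (-T) T) y).2]
  · rcases le_or_gt |y| (T - 1) with h | h
    · rw [cutoff_eq_one h, indicator_Icc_of_abs_le (by linarith), sub_self]
    · have : T < |y| := by
        by_contra! h'
        exact hy ⟨h.le, by linarith⟩
      rw [cutoff_eq this, indicator_Icc_of_lt_abs this, sub_self]

theorem smoothedZeroSum_le {S : ℝ} : smoothedZeroSum S ≤ zeroSum (S + 1) := by
  refine Finset.sum_le_sum fun ρ hρ ↦ ?_
  have hre := ((Finite.mem_toFinset _).1 hρ).2.2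
  gcongr
  exact mul_le_of_le_one_left (logRatio_nonneg hre.le) (cutoff_le_one _ _)

theorem zeroSum_le {S : ℝ} (hS : 0 ≤ S) : zeroSum S ≤ smoothedZeroSum S := by
  have subset : (zerosRightOfLine_finite S).toFinset ⊆
      (zerosRightOfLine_finite (S + 1)).toFinset := fun ρ hρ ↦ by
    obtain ⟨hζ, him, hre⟩ := (Finite.mem_toFinset _).1 hρ
    exact (Finite.mem_toFinset _).2 ⟨hζ, ⟨by linarith, by linarith⟩, hre⟩
  calc zeroSum S = ∑ ρ ∈ (zerosRightOfLine_finite S).toFinset,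
        analyticOrderNatAt riemannZeta ρ * (cutoff S ρ.im * logRatio ρ) :=
        Finset.sum_congr rfl fun ρ hρ ↦ by
          obtain ⟨-, him, -⟩ := (Finite.mem_toFinset _).1 hρ
          rw [cutoff_eq_one (abs_le.2 him), one_mul, logRatio]
    _ ≤ smoothedZeroSum S := Finset.sum_le_sum_of_subset_of_nonneg subset fun ρ hρ _ ↦ by
        have hre := ((Finite.mem_toFinset _).1 hρ).2.2
        exact mul_nonneg (Nat.cast_nonneg _)
          (mul_nonneg (cutoff_nonneg hS _) (logRatio_nonneg hre.le))

theorem log_sub_one_div_sq_le (hT : 3 ≤ T) :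
    Real.log (T - 1) / (T - 1) ^ 2 ≤ 3 * (Real.log T / T ^ 2) := by
  have log_nonneg : 0 ≤ Real.log T := Real.log_nonneg (by linarith)
  have log_le : Real.log (T - 1) ≤ Real.log T := Real.log_le_log (by linarith) (by linarith)
  calc Real.log (T - 1) / (T - 1) ^ 2 ≤ Real.log T / (1 / 3 * T ^ 2) :=
        div_le_div₀ log_nonneg log_le (by positivity) (by nlinarith)
    _ = 3 * (Real.log T / T ^ 2) := by ring

end Truncation

end BalazardSaiasYor

theorem theorem2 :
    (∀ T : ℝ, 3 ≤ T →
      IntervalIntegrable BalazardSaiasYor.integrand MeasureTheory.volume (-T) T) ∧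
    ∃ C : ℝ, ∀ T : ℝ, 3 ≤ T →
      |BalazardSaiasYor.truncatedIntegral T - 2 * Real.pi * BalazardSaiasYor.zeroSum T| ≤
        C * (1 / T ^ 2 * Real.log T) := by
  refine ⟨fun T _ ↦ BalazardSaiasYor.intervalIntegrable_integrand (-T) T, ?_⟩
  obtain ⟨C, hC, smoothed⟩ := BalazardSaiasYor.exists_abs_integral_cutoff_sub_le
  refine ⟨3 * C + 64, fun T hT ↦ ?_⟩
  have inner := abs_le.1 (smoothed (T - 1) (by linarith))
  have outer := abs_le.1 (smoothed T (by linarith))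
  have inner_error := mul_le_mul_of_nonneg_left (BalazardSaiasYor.log_sub_one_div_sq_le hT) hC
  have inner_sum := BalazardSaiasYor.smoothedZeroSum_le (S := T - 1)
  rw [sub_add_cancel] at inner_sum
  have outer_sum := BalazardSaiasYor.zeroSum_le (S := T) (by linarith)
  rw [one_div_mul_eq_div, abs_le]
  constructor
  · linarith [BalazardSaiasYor.integral_cutoff_sub_truncatedIntegral_le hT,
      mul_le_mul_of_nonneg_left outer_sum Real.two_pi_pos.le]
  · linarith [BalazardSaiasYor.truncatedIntegral_sub_integral_cutoff_le hT,
      mul_le_mul_of_nonneg_left inner_sum Real.two_pi_pos.le]
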